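/- Let $n\ge 1$. For a commutative ring $A$ with commuting derivations $\partial/\partial x_1,\dots,\partial/\partial x_n$, let $A((\partial_1^{-1}))\cdots((\partial_n^{-1}))$ be the iterated ring of formal pseudo-differential operators: at each step, $B((\partial_i^{-1}))$ consists of the formal series $\sum_{j\le m} b_j\partial_i^j$ ($m\in\mathbf Z$, $b_j\in B$), multiplied by the Leibniz rule $$(a\,\partial_i^{p})(b\,\partial_i^{q})=\sum_{k\ge 0}\binom{p}{k}\,a\,\frac{\partial^k b}{\partial x_i^k}\,\partial_i^{p+q-k},$$ and all $\partial/\partial x_l$ are extended to it coefficientwise. For a set $X$ of such operators let $X_-$ be the set of those $\sum_j b_j\partial_n^j\in X$ with $b_j=0$ for all $j\ge 0$. (a) Let $k$ be a field of characteristic $0$, $E=k[[x_1,\dots,x_n]]((\partial_1^{-1}))\cdots((\partial_n^{-1}))$, and let $L_i\in\partial_i+E_-$ for $i=1,\dots,n$. Then the following are equivalent: (i) $[L_i,L_j]=0$ for all $i,j$; (ii) there is $S\in 1+E_-$, invertible in $E$, with $L_i=S^{-1}\partial_iS$ for all $i=1,\dots,n$. Moreover, if $S$ is as in (ii), then an invertible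 $S'\in E$ is as in (ii) (that is, $S'\in 1+E_-$ and $L_i=S'^{-1}\partial_iS'$ for all $i$) if and only if $S'S^{-1}\in 1+\bigl(k((\partial_1^{-1}))\cdots((\partial_n^{-1}))\cap E_-\bigr)$. (b) Let $\mathcal R$ be the set of those elements of $C^\infty(\mathbf R^n)((\partial_1^{-1}))\cdots((\partial_n^{-1}))$ (real functions) all of whose coefficients are rapidly decreasing (Schwartz) functions on $\mathbf R^n$, and let $L_i\in\partial_i+\mathcal R_-$ for $i=1,\dots,n$. Then (ii) implies (i), where in (ii) $E_-$ is replaced by $\mathcal R_-$ and inverses are taken in $C^\infty(\mathbf R^n)((\partial_1^{-1}))\cdots((\partial_n^{-1}))$; if $n\ge 2$, then also (i) implies (ii). Moreover, if $S$ is as in (ii), then an invertible $S'$ is as in (ii) if and only if $S'S^{-1}\in 1+\bigl(\mathbf R((\partial_1^{-1}))\cdots((\partial_n^{-1}))\cap \mathcal R_-\bigr)$. -/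

import Mathlib

open scoped ContDiff

universe u

namespace FormalPDO

/-- A derivation of a (not necessarily commutative) ring: an additive map with the Leibniz rule. -/
structure RingDer (A : Type u) [Ring A] extends A →+ A where
  leibniz' : ∀ a b : A, toFun (a * b) = toFun a * b + a * toFun b

namespace RingDer

variable {A : Type u} [Ring A]

instance : FunLike (RingDer A) A A where
  coe D := D.toFun
  coe_injective D D' h := by
    obtain ⟨⟨⟨f, _⟩, _⟩, _⟩ := D
    obtain ⟨⟨⟨g, _⟩, _⟩, _⟩ := D'
    cases h
    rfl

instance : AddMonoidHomClass (RingDer A) A A where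
  map_add D := D.map_add'
  map_zero D := D.map_zero'

theorem leibniz (D : RingDer A) (a b : A) : D (a * b) = D a * b + a * D b := D.leibniz' a b

theorem map_one (D : RingDer A) : D 1 = 0 := by
  have h := D.leibniz 1 1
  simpa using h

/-- The `k`-th iterate of a derivation, as an additive map. -/
def iter (D : RingDer A) : ℕ → A →+ A
  | 0 => AddMonoidHom.id A
  | k + 1 => (D : A →+ A).comp (iter D k)

@[simp] theorem iter_zero (D : RingDer A) (a : A) : D.iter 0 a = a := rfl

theorem iter_succ (D : RingDer A) (k : ℕ) (a : A) : D.iter (k + 1) a = D (D.iter k a) := rfl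

theorem iter_iter (D : RingDer A) (k l : ℕ) (a : A) : D.iter k (D.iter l a) = D.iter (k + l) a := by
  induction k with
  | zero => simp
  | succ k ih => rw [iter_succ, ih, Nat.add_right_comm, iter_succ]

theorem iter_one (D : RingDer A) (k : ℕ) (hk : k ≠ 0) : D.iter k (1 : A) = 0 := by
  obtain ⟨k, rfl⟩ := Nat.exists_eq_succ_of_ne_zero hk
  induction k with
  | zero => simp [iter_succ, D.map_one]
  | succ k ih => rw [Nat.succ_eq_add_one, iter_succ, ih (Nat.succ_ne_zero k), map_zero]

theorem iter_mul (D : RingDer A) (k : ℕ) (a b : A) :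
    D.iter k (a * b) =
      ∑ p ∈ Finset.HasAntidiagonal.antidiagonal k,
        (k.choose p.1) • (D.iter p.1 a * D.iter p.2 b) := by
  induction k with
  | zero => simp
  | succ n ih =>
    rw [Finset.sum_antidiagonal_choose_succ_nsmul (fun i j => D.iter i a * D.iter j b) n]
    simp only [iter_succ, ih, map_sum, map_nsmul, leibniz, smul_add, Finset.sum_add_distrib]
    rw [add_comm]
    congr 1
    refine Finset.sum_congr rfl fun ij hij => ?_
    rw [n.choose_symm_of_eq_add (Finset.HasAntidiagonal.mem_antidiagonal.1 hij).symm]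

theorem iter_comm (D D' : RingDer A) (h : ∀ a, D (D' a) = D' (D a)) (k : ℕ) (a : A) :
    D.iter k (D' a) = D' (D.iter k a) := by
  induction k with
  | zero => rfl
  | succ k ih => rw [iter_succ, ih, h, iter_succ]

end RingDer

section PDO

variable {A : Type u} [Ring A]

/-- The coefficient at `∂ ^ m` of the product of the monomials `a ∂ ^ i` and `b ∂ ^ j`: by the
Leibniz rule it is `binom(i, k) a D ^ k (b)` if `m = i + j - k` with `k ≥ 0`, and `0` otherwise. -/
noncomputable def monoMul (D : RingDer A) (i j m : ℤ) (a b : A) : A :=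
  if m ≤ i + j then Ring.choose i (i + j - m).toNat • (a * D.iter (i + j - m).toNat b) else 0

section monoMul

variable (D : RingDer A) (i j m : ℤ)

theorem monoMul_of_lt (a b : A) (h : i + j < m) : monoMul D i j m a b = 0 :=
  if_neg (not_le.2 h)

theorem monoMul_nat (a b : A) (k : ℕ) (h : i + j = m + k) :
    monoMul D i j m a b = Ring.choose i k • (a * D.iter k b) := by
  have : (i + j - m).toNat = k := by omega
  rw [monoMul, if_pos (by omega), this]

theorem monoMul_add_left (a a' b : A) :
    monoMul D i j m (a + a') b = monoMul D i j m a b + monoMul D i j m a' b := by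
  unfold monoMul
  split_ifs
  · rw [add_mul, smul_add]
  · simp

theorem monoMul_add_right (a b b' : A) :
    monoMul D i j m a (b + b') = monoMul D i j m a b + monoMul D i j m a b' := by
  unfold monoMul
  split_ifs
  · rw [map_add, mul_add, smul_add]
  · simp

@[simp] theorem monoMul_zero_left (b : A) : monoMul D i j m 0 b = 0 := by simp [monoMul]

@[simp] theorem monoMul_zero_right (a : A) : monoMul D i j m a 0 = 0 := by simp [monoMul]

theorem monoMul_sum_left {ι : Type*} (s : Finset ι) (f : ι → A) (b : A) :
    monoMul D i j m (∑ x ∈ s, f x) b = ∑ x ∈ s, monoMul D i j m (f x) b :=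
  map_sum (AddMonoidHom.mk' (fun a => monoMul D i j m a b)
    (fun a a' => monoMul_add_left D i j m a a' b)) f s

theorem monoMul_sum_right {ι : Type*} (s : Finset ι) (a : A) (f : ι → A) :
    monoMul D i j m a (∑ x ∈ s, f x) = ∑ x ∈ s, monoMul D i j m a (f x) :=
  map_sum (AddMonoidHom.mk' (fun b => monoMul D i j m a b)
    (fun b b' => monoMul_add_right D i j m a b b')) f s

theorem monoMul_assoc_nat (a b c : A) (i j : ℤ) (w : ℕ) :
    ∑ p ∈ Finset.HasAntidiagonal.antidiagonal w,
      Ring.choose (i + j - p.1) p.2 • ((Ring.choose i p.1 • (a * D.iter p.1 b)) * D.iter p.2 c) =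
    ∑ p ∈ Finset.HasAntidiagonal.antidiagonal w,
      Ring.choose i p.1 • (a * D.iter p.1 (Ring.choose j p.2 • (b * D.iter p.2 c))) := by
  have key : ∀ s t q : ℕ, (Ring.choose i s * (Ring.choose (i - s) t * Ring.choose j q) : ℤ) =
      Ring.choose i (s + t) * (Ring.choose j q * ((s + t).choose s : ℤ)) := by
    intro s t q
    have := Ring.choose_smul_choose i (Nat.le_add_right s t)
    rw [nsmul_eq_mul, Nat.add_sub_cancel_left] at this
    linear_combination (-(Ring.choose j q : ℤ)) * this
  have hL : ∀ p : ℕ × ℕ,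
      Ring.choose (i + j - p.1) p.2 • ((Ring.choose i p.1 • (a * D.iter p.1 b)) * D.iter p.2 c) =
      ∑ r ∈ Finset.HasAntidiagonal.antidiagonal p.2,
        (Ring.choose i p.1 * (Ring.choose (i - p.1) r.1 * Ring.choose j r.2)) •
          (a * D.iter p.1 b * D.iter (r.1 + r.2) c) := by
    intro p
    have h1 : i + j - (p.1 : ℤ) = (i - p.1) + j := by ring
    rw [h1, Ring.add_choose_eq p.2 (Commute.all (i - (p.1 : ℤ)) j), Finset.sum_smul]
    refine Finset.sum_congr rfl fun r hr => ?_
    rw [Finset.HasAntidiagonal.mem_antidiagonal.1 hr, smul_mul_assoc, smul_smul]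
    congr 1
    ring
  have hR : ∀ p : ℕ × ℕ,
      Ring.choose i p.1 • (a * D.iter p.1 (Ring.choose j p.2 • (b * D.iter p.2 c))) =
      ∑ r ∈ Finset.HasAntidiagonal.antidiagonal p.1,
        (Ring.choose i (r.1 + r.2) * (Ring.choose j p.2 * ((r.1 + r.2).choose r.1 : ℤ))) •
          (a * D.iter r.1 b * D.iter (r.2 + p.2) c) := by
    intro p
    rw [map_zsmul, D.iter_mul, mul_smul_comm, smul_smul, Finset.mul_sum, Finset.smul_sum]
    refine Finset.sum_congr rfl fun r hr => ?_
    rw [Finset.HasAntidiagonal.mem_antidiagonal.1 hr, D.iter_iter, mul_smul_comm,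
      ← natCast_zsmul, smul_smul, mul_assoc a, mul_assoc (Ring.choose i p.1 : ℤ)]
  rw [Finset.sum_congr rfl fun p _ => hL p, Finset.sum_congr rfl fun p _ => hR p,
    Finset.sum_sigma', Finset.sum_sigma']
  refine Finset.sum_nbij' (fun x => ⟨(x.1.1 + x.2.1, x.2.2), (x.1.1, x.2.1)⟩)
    (fun x => ⟨(x.2.1, x.2.2 + x.1.2), (x.2.2, x.1.2)⟩) ?_ ?_ ?_ ?_ ?_
  · rintro ⟨⟨x, y⟩, ⟨z, w⟩⟩ h
    simp only [Finset.mem_sigma, Finset.HasAntidiagonal.mem_antidiagonal] at h ⊢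
    exact ⟨by omega, trivial⟩
  · rintro ⟨⟨x, y⟩, ⟨z, w⟩⟩ h
    simp only [Finset.mem_sigma, Finset.HasAntidiagonal.mem_antidiagonal] at h ⊢
    exact ⟨by omega, trivial⟩
  · rintro ⟨⟨x, y⟩, ⟨z, w⟩⟩ h
    simp only [Finset.mem_sigma, Finset.HasAntidiagonal.mem_antidiagonal] at h ⊢
    obtain ⟨h1, h2⟩ := h
    subst h2
    rfl
  · rintro ⟨⟨x, y⟩, ⟨z, w⟩⟩ h
    simp only [Finset.mem_sigma, Finset.HasAntidiagonal.mem_antidiagonal] at h ⊢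
    obtain ⟨h1, h2⟩ := h
    subst h2
    rfl
  · rintro ⟨⟨x, y⟩, ⟨z, w⟩⟩ h
    simp only [key]

end monoMul

/-- The sequences indexed by `ℤ` that vanish at all large indices. -/
def boundedAbove (A : Type u) [Ring A] : AddSubgroup (ℤ → A) where
  carrier := {f | ∃ N : ℤ, ∀ i, N < i → f i = 0}
  zero_mem' := ⟨0, fun _ _ => rfl⟩
  add_mem' := by
    rintro f g ⟨N, hN⟩ ⟨M, hM⟩
    refine ⟨max N M, fun i hi => ?_⟩
    rw [Pi.add_apply, hN i (lt_of_le_of_lt (le_max_left _ _) hi),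
      hM i (lt_of_le_of_lt (le_max_right _ _) hi), add_zero]
  neg_mem' := by
    rintro f ⟨N, hN⟩
    exact ⟨N, fun i hi => by rw [Pi.neg_apply, hN i hi, neg_zero]⟩

/-- The formal pseudo-differential operators `∑ a_i ∂ ^ i` (with `i` bounded above) with
coefficients in the ring `A`, where `∂` acts on `A` through the derivation `D`. This is the ring
`A((∂⁻¹))`. -/
def PDO (_D : RingDer A) : Type u := boundedAbove A

namespace PDO

variable {D : RingDer A}

instance : AddCommGroup (PDO D) := inferInstanceAs (AddCommGroup (boundedAbove A))

/-- The coefficient of `∂ ^ i`. -/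
def coeff (L : PDO D) (i : ℤ) : A := L.1 i

/-- The operator with given coefficients. -/
def mk (f : ℤ → A) (h : ∃ N : ℤ, ∀ i, N < i → f i = 0) : PDO D := ⟨f, h⟩

@[simp] theorem coeff_mk (f : ℤ → A) (h : ∃ N : ℤ, ∀ i, N < i → f i = 0) (i : ℤ) :
    (mk f h : PDO D).coeff i = f i := rfl

theorem bounded (L : PDO D) : ∃ N : ℤ, ∀ i, N < i → L.coeff i = 0 := L.2

@[ext] theorem ext {L M : PDO D} (h : ∀ i, L.coeff i = M.coeff i) : L = M :=
  Subtype.ext (funext h)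

@[simp] theorem coeff_add (L M : PDO D) (i : ℤ) : (L + M).coeff i = L.coeff i + M.coeff i := rfl

@[simp] theorem coeff_zero (i : ℤ) : (0 : PDO D).coeff i = 0 := rfl

@[simp] theorem coeff_neg (L : PDO D) (i : ℤ) : (-L).coeff i = -L.coeff i := rfl

@[simp] theorem coeff_sub (L M : PDO D) (i : ℤ) : (L - M).coeff i = L.coeff i - M.coeff i := rfl

/-- The coefficient at `∂ ^ m` of the product of two operators. -/
noncomputable def mulCoeff (L M : PDO D) (m : ℤ) : A :=
  ∑ᶠ p : ℤ × ℤ, monoMul D p.1 p.2 m (L.coeff p.1) (M.coeff p.2)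

theorem mulCoeff_eq_sum (L M : PDO D) (m N K : ℤ) (hL : ∀ i, N < i → L.coeff i = 0)
    (hM : ∀ i, K < i → M.coeff i = 0) (s t : Finset ℤ)
    (hs : Finset.Icc (m - K) N ⊆ s) (ht : Finset.Icc (m - N) K ⊆ t) :
    mulCoeff L M m = ∑ i ∈ s, ∑ j ∈ t, monoMul D i j m (L.coeff i) (M.coeff j) := by
  rw [mulCoeff, finsum_eq_sum_of_support_subset (s := s ×ˢ t), Finset.sum_product]
  rintro ⟨i, j⟩ hp
  rw [Function.mem_support] at hp
  have hi : i ≤ N := by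
    by_contra h
    exact hp (by simp [hL i (not_le.1 h)])
  have hj : j ≤ K := by
    by_contra h
    exact hp (by simp [hM j (not_le.1 h)])
  have hm : m ≤ i + j := by
    by_contra h
    exact hp (monoMul_of_lt D i j m _ _ (not_le.1 h))
  have h1 : i ∈ s := hs (Finset.mem_Icc.2 ⟨by omega, hi⟩)
  have h2 : j ∈ t := ht (Finset.mem_Icc.2 ⟨by omega, hj⟩)
  simp [h1, h2]

theorem mulCoeff_bounded (L M : PDO D) : ∃ N : ℤ, ∀ i, N < i → mulCoeff L M i = 0 := by
  obtain ⟨N, hN⟩ := L.bounded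
  obtain ⟨K, hK⟩ := M.bounded
  refine ⟨N + K, fun i hi => ?_⟩
  rw [mulCoeff_eq_sum L M i N K hN hK ∅ ∅]
  · simp
  · rw [Finset.Icc_eq_empty (by omega)]
  · rw [Finset.Icc_eq_empty (by omega)]

noncomputable instance : Mul (PDO D) := ⟨fun L M => mk (mulCoeff L M) (mulCoeff_bounded L M)⟩

theorem coeff_mul (L M : PDO D) (m : ℤ) :
    (L * M).coeff m = ∑ᶠ p : ℤ × ℤ, monoMul D p.1 p.2 m (L.coeff p.1) (M.coeff p.2) := rfl

theorem coeff_mul_eq_sum (L M : PDO D) (m N K : ℤ) (hL : ∀ i, N < i → L.coeff i = 0)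
    (hM : ∀ i, K < i → M.coeff i = 0) (s t : Finset ℤ)
    (hs : Finset.Icc (m - K) N ⊆ s) (ht : Finset.Icc (m - N) K ⊆ t) :
    (L * M).coeff m = ∑ i ∈ s, ∑ j ∈ t, monoMul D i j m (L.coeff i) (M.coeff j) :=
  mulCoeff_eq_sum L M m N K hL hM s t hs ht

theorem coeff_mul_eq_zero (L M : PDO D) (m N K : ℤ) (hL : ∀ i, N < i → L.coeff i = 0)
    (hM : ∀ i, K < i → M.coeff i = 0) (h : N + K < m) : (L * M).coeff m = 0 := by
  rw [coeff_mul_eq_sum L M m N K hL hM ∅ ∅]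
  · simp
  · rw [Finset.Icc_eq_empty (by omega)]
  · rw [Finset.Icc_eq_empty (by omega)]

/-- The monomial `a ∂ ^ i`. -/
def single (i : ℤ) (a : A) : PDO D :=
  mk (fun j => if j = i then a else 0) ⟨i, fun j hj => if_neg (by omega)⟩

theorem coeff_single (i j : ℤ) (a : A) : (single i a : PDO D).coeff j = if j = i then a else 0 :=
  rfl

theorem coeff_single_mul (i : ℤ) (a : A) (M : PDO D) (m K : ℤ)
    (hM : ∀ i, K < i → M.coeff i = 0) (t : Finset ℤ) (ht : Finset.Icc (m - i) K ⊆ t) :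
    (single i a * M).coeff m = ∑ j ∈ t, monoMul D i j m a (M.coeff j) := by
  rw [coeff_mul_eq_sum (single i a) M m i K (fun j hj => if_neg (by omega)) hM
    (insert i (Finset.Icc (m - K) i)) t (Finset.subset_insert _ _) ht]
  rw [Finset.sum_eq_single i]
  · simp [coeff_single]
  · intro b _ hb
    simp [coeff_single, hb]
  · simp

instance : One (PDO D) := ⟨single 0 1⟩

theorem coeff_one (i : ℤ) : (1 : PDO D).coeff i = if i = 0 then 1 else 0 := rfl

protected theorem one_mul (L : PDO D) : 1 * L = L := by
  ext m
  obtain ⟨N, hN⟩ := L.bounded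
  have : (1 : PDO D) = single 0 1 := rfl
  rw [this, coeff_single_mul 0 1 L m N hN (insert m (Finset.Icc (m - 0) N))
    (Finset.subset_insert _ _), Finset.sum_eq_single m]
  · rw [monoMul_nat D 0 m m _ _ 0 (by simp)]
    simp
  · intro j _ hj
    rcases lt_or_ge (0 + j) m with h | h
    · exact monoMul_of_lt D _ _ _ _ _ h
    · rw [monoMul_nat D 0 j m _ _ (j - m).toNat (by omega),
        Ring.choose_zero_pos ℤ (by omega : 0 < (j - m).toNat), zero_smul]
  · simp

protected theorem mul_one (L : PDO D) : L * 1 = L := by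
  ext m
  obtain ⟨N, hN⟩ := L.bounded
  rw [coeff_mul_eq_sum L 1 m N 0 hN (fun j hj => if_neg (by omega))
    (insert m (Finset.Icc (m - 0) N)) (insert 0 (Finset.Icc (m - N) 0))
    (Finset.subset_insert _ _) (Finset.subset_insert _ _), Finset.sum_eq_single m]
  · rw [Finset.sum_eq_single 0]
    · rw [monoMul_nat D m 0 m _ _ 0 (by simp)]
      simp [coeff_one]
    · intro j _ hj
      simp [coeff_one, hj]
    · simp
  · intro i _ hi
    refine Finset.sum_eq_zero fun j _ => ?_
    by_cases hj : j = 0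
    · subst hj
      rcases lt_or_ge (i + 0) m with h | h
      · exact monoMul_of_lt D _ _ _ _ _ h
      · rw [monoMul_nat D i 0 m _ _ (i - m).toNat (by omega), coeff_one, if_pos rfl,
          D.iter_one _ (by omega), mul_zero, smul_zero]
    · simp [coeff_one, hj]
  · simp

protected theorem zero_mul (L : PDO D) : 0 * L = 0 := by
  ext m
  simp [coeff_mul]

protected theorem mul_zero (L : PDO D) : L * 0 = 0 := by
  ext m
  simp [coeff_mul]

protected theorem left_distrib (L M P : PDO D) : L * (M + P) = L * M + L * P := by
  ext m
  obtain ⟨N, hN⟩ := L.bounded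
  obtain ⟨K, hK⟩ := M.bounded
  obtain ⟨J, hJ⟩ := P.bounded
  have hK' : ∀ i, max K J < i → M.coeff i = 0 :=
    fun i hi => hK i (lt_of_le_of_lt (le_max_left _ _) hi)
  have hJ' : ∀ i, max K J < i → P.coeff i = 0 :=
    fun i hi => hJ i (lt_of_le_of_lt (le_max_right _ _) hi)
  have hS : ∀ i, max K J < i → (M + P).coeff i = 0 :=
    fun i hi => by rw [coeff_add, hK' i hi, hJ' i hi, add_zero]
  rw [coeff_add, coeff_mul_eq_sum L (M + P) m N _ hN hS _ _ subset_rfl subset_rfl,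
    coeff_mul_eq_sum L M m N _ hN hK' _ _ subset_rfl subset_rfl,
    coeff_mul_eq_sum L P m N _ hN hJ' _ _ subset_rfl subset_rfl]
  simp only [coeff_add, monoMul_add_right, Finset.sum_add_distrib]

protected theorem right_distrib (M P L : PDO D) : (M + P) * L = M * L + P * L := by
  ext m
  obtain ⟨N, hN⟩ := L.bounded
  obtain ⟨K, hK⟩ := M.bounded
  obtain ⟨J, hJ⟩ := P.bounded
  have hK' : ∀ i, max K J < i → M.coeff i = 0 :=
    fun i hi => hK i (lt_of_le_of_lt (le_max_left _ _) hi)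
  have hJ' : ∀ i, max K J < i → P.coeff i = 0 :=
    fun i hi => hJ i (lt_of_le_of_lt (le_max_right _ _) hi)
  have hS : ∀ i, max K J < i → (M + P).coeff i = 0 :=
    fun i hi => by rw [coeff_add, hK' i hi, hJ' i hi, add_zero]
  rw [coeff_add, coeff_mul_eq_sum (M + P) L m _ N hS hN _ _ subset_rfl subset_rfl,
    coeff_mul_eq_sum M L m _ N hK' hN _ _ subset_rfl subset_rfl,
    coeff_mul_eq_sum P L m _ N hJ' hN _ _ subset_rfl subset_rfl]
  simp only [coeff_add, monoMul_add_left, Finset.sum_add_distrib]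

theorem mono_assoc (i j l m : ℤ) (a b c : A) (s t : Finset ℤ)
    (hs : Finset.Icc (m - l) (i + j) ⊆ s) (ht : Finset.Icc (m - i) (j + l) ⊆ t) :
    ∑ p ∈ s, monoMul D p l m (monoMul D i j p a b) c =
      ∑ q ∈ t, monoMul D i q m a (monoMul D j l q b c) := by
  rcases lt_or_ge (i + j + l) m with h | h
  · rw [Finset.sum_eq_zero, Finset.sum_eq_zero]
    · intro q _
      rcases lt_or_ge (j + l) q with h' | h'
      · rw [monoMul_of_lt D j l q _ _ h', monoMul_zero_right]
      · exact monoMul_of_lt D _ _ _ _ _ (by omega)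
    · intro p _
      rcases lt_or_ge (i + j) p with h' | h'
      · rw [monoMul_of_lt D i j p _ _ h', monoMul_zero_left]
      · exact monoMul_of_lt D _ _ _ _ _ (by omega)
  · obtain ⟨w, hw⟩ : ∃ w : ℕ, i + j + l = m + w := ⟨(i + j + l - m).toNat, by omega⟩
    have h1 : ∑ p ∈ s, monoMul D p l m (monoMul D i j p a b) c =
        ∑ p ∈ Finset.HasAntidiagonal.antidiagonal w,
          Ring.choose (i + j - p.1) p.2 •
            ((Ring.choose i p.1 • (a * D.iter p.1 b)) * D.iter p.2 c) := by
      rw [← Finset.sum_subset hs]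
      · refine Finset.sum_nbij' (fun p => ((i + j - p).toNat, (p + l - m).toNat))
          (fun x => i + j - x.1) ?_ ?_ ?_ ?_ ?_
        · intro p hp
          rw [Finset.mem_Icc] at hp
          rw [Finset.HasAntidiagonal.mem_antidiagonal]
          omega
        · intro x hx
          rw [Finset.HasAntidiagonal.mem_antidiagonal] at hx
          rw [Finset.mem_Icc]
          omega
        · intro p hp
          rw [Finset.mem_Icc] at hp
          simp only
          omega
        · rintro ⟨x, y⟩ hx
          rw [Finset.HasAntidiagonal.mem_antidiagonal] at hx
          simp only at hx
          simp only [Prod.mk.injEq]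
          omega
        · intro p hp
          rw [Finset.mem_Icc] at hp
          rw [monoMul_nat D i j p a b (i + j - p).toNat (by omega),
            monoMul_nat D p l m _ _ (p + l - m).toNat (by omega)]
          have : i + j - ((i + j - p).toNat : ℤ) = p := by omega
          rw [this]
      · intro p _ hp
        rw [Finset.mem_Icc, not_and_or] at hp
        rcases hp with hp | hp
        · exact monoMul_of_lt D _ _ _ _ _ (by omega)
        · rw [monoMul_of_lt D i j p _ _ (by omega), monoMul_zero_left]
    have h2 : ∑ q ∈ t, monoMul D i q m a (monoMul D j l q b c) =
        ∑ p ∈ Finset.HasAntidiagonal.antidiagonal w,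
          Ring.choose i p.1 • (a * D.iter p.1 (Ring.choose j p.2 • (b * D.iter p.2 c))) := by
      rw [← Finset.sum_subset ht]
      · refine Finset.sum_nbij' (fun q => ((i + q - m).toNat, (j + l - q).toNat))
          (fun x => j + l - x.2) ?_ ?_ ?_ ?_ ?_
        · intro p hp
          rw [Finset.mem_Icc] at hp
          rw [Finset.HasAntidiagonal.mem_antidiagonal]
          omega
        · intro x hx
          rw [Finset.HasAntidiagonal.mem_antidiagonal] at hx
          rw [Finset.mem_Icc]
          omega
        · intro p hp
          rw [Finset.mem_Icc] at hp
          simp only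
          omega
        · rintro ⟨x, y⟩ hx
          rw [Finset.HasAntidiagonal.mem_antidiagonal] at hx
          simp only at hx
          simp only [Prod.mk.injEq]
          omega
        · intro q hq
          rw [Finset.mem_Icc] at hq
          rw [monoMul_nat D j l q b c (j + l - q).toNat (by omega),
            monoMul_nat D i q m _ _ (i + q - m).toNat (by omega)]
      · intro q _ hq
        rw [Finset.mem_Icc, not_and_or] at hq
        rcases hq with hq | hq
        · exact monoMul_of_lt D _ _ _ _ _ (by omega)
        · rw [monoMul_of_lt D j l q _ _ (by omega), monoMul_zero_right]
    rw [h1, h2, monoMul_assoc_nat]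

protected theorem mul_assoc (L M P : PDO D) : L * M * P = L * (M * P) := by
  ext m
  obtain ⟨N, hN⟩ := L.bounded
  obtain ⟨K, hK⟩ := M.bounded
  obtain ⟨J, hJ⟩ := P.bounded
  set s := Finset.Icc (m - K - J) N with hs
  set t := Finset.Icc (m - N - J) K with ht
  set r := Finset.Icc (m - N - K) J with hr
  set p := Finset.Icc (m - J) (N + K) with hp
  set q := Finset.Icc (m - N) (K + J) with hq
  have e1 : (L * M * P).coeff m = ∑ i ∈ s, ∑ j ∈ t, ∑ l ∈ r, ∑ x ∈ p,
      monoMul D x l m (monoMul D i j x (L.coeff i) (M.coeff j)) (P.coeff l) := by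
    rw [coeff_mul_eq_sum (L * M) P m (N + K) J
      (fun i hi => coeff_mul_eq_zero L M i N K hN hK hi) hJ p r subset_rfl
      (Finset.Icc_subset_Icc (by omega) le_rfl)]
    have : ∀ x ∈ p, ∀ l ∈ r, monoMul D x l m ((L * M).coeff x) (P.coeff l) =
        ∑ i ∈ s, ∑ j ∈ t,
          monoMul D x l m (monoMul D i j x (L.coeff i) (M.coeff j)) (P.coeff l) := by
      intro x hx l _
      rw [hp, Finset.mem_Icc] at hx
      rw [coeff_mul_eq_sum L M x N K hN hK s t (Finset.Icc_subset_Icc (by omega) le_rfl)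
        (Finset.Icc_subset_Icc (by omega) le_rfl)]
      simp only [monoMul_sum_left]
    rw [Finset.sum_congr rfl fun x hx => Finset.sum_congr rfl fun l hl => this x hx l hl]
    rw [Finset.sum_comm]
    simp only [Finset.sum_comm (s := p)]
    rw [Finset.sum_comm]
    refine Finset.sum_congr rfl fun i _ => ?_
    rw [Finset.sum_comm]
  have e2 : (L * (M * P)).coeff m = ∑ i ∈ s, ∑ j ∈ t, ∑ l ∈ r, ∑ y ∈ q,
      monoMul D i y m (L.coeff i) (monoMul D j l y (M.coeff j) (P.coeff l)) := by
    rw [coeff_mul_eq_sum L (M * P) m N (K + J) hN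
      (fun i hi => coeff_mul_eq_zero M P i K J hK hJ hi) s q
      (Finset.Icc_subset_Icc (by omega) le_rfl) subset_rfl]
    refine Finset.sum_congr rfl fun i _ => ?_
    have : ∀ y ∈ q, monoMul D i y m (L.coeff i) ((M * P).coeff y) =
        ∑ j ∈ t, ∑ l ∈ r,
          monoMul D i y m (L.coeff i) (monoMul D j l y (M.coeff j) (P.coeff l)) := by
      intro y hy
      rw [hq, Finset.mem_Icc] at hy
      rw [coeff_mul_eq_sum M P y K J hK hJ t r (Finset.Icc_subset_Icc (by omega) le_rfl)
        (Finset.Icc_subset_Icc (by omega) le_rfl)]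
      simp only [monoMul_sum_right]
    rw [Finset.sum_congr rfl this, Finset.sum_comm]
    refine Finset.sum_congr rfl fun j _ => ?_
    rw [Finset.sum_comm]
  rw [e1, e2]
  refine Finset.sum_congr rfl fun i hi => Finset.sum_congr rfl fun j hj =>
    Finset.sum_congr rfl fun l hl => ?_
  rw [hs, Finset.mem_Icc] at hi
  rw [ht, Finset.mem_Icc] at hj
  rw [hr, Finset.mem_Icc] at hl
  exact mono_assoc i j l m _ _ _ p q (Finset.Icc_subset_Icc (by omega) (by omega))
    (Finset.Icc_subset_Icc (by omega) (by omega))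

noncomputable instance : Ring (PDO D) :=
  { (inferInstance : AddCommGroup (PDO D)) with
    mul := (· * ·)
    one := 1
    mul_assoc := PDO.mul_assoc
    one_mul := PDO.one_mul
    mul_one := PDO.mul_one
    zero_mul := PDO.zero_mul
    mul_zero := PDO.mul_zero
    left_distrib := PDO.left_distrib
    right_distrib := PDO.right_distrib }

/-- Application of an additive map to all coefficients. -/
def mapCoeff (g : A →+ A) (L : PDO D) : PDO D :=
  mk (fun i => g (L.coeff i)) (by
    obtain ⟨N, hN⟩ := L.bounded
    exact ⟨N, fun i hi => by rw [hN i hi, map_zero]⟩)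

@[simp] theorem coeff_mapCoeff (g : A →+ A) (L : PDO D) (i : ℤ) :
    (mapCoeff g L).coeff i = g (L.coeff i) := rfl

/-- A derivation of `A` that commutes with `D`, extended to `A((∂⁻¹))` coefficientwise. -/
noncomputable def extendDer (D' : RingDer A) (h : ∀ a, D (D' a) = D' (D a)) : RingDer (PDO D) where
  toFun L := mapCoeff (D' : A →+ A) L
  map_zero' := by ext i; simp
  map_add' L M := by ext i; simp
  leibniz' L M := by
    ext m
    obtain ⟨N, hN⟩ := L.bounded
    obtain ⟨K, hK⟩ := M.bounded
    have hN' : ∀ i, N < i → D' (L.coeff i) = 0 := fun i hi => by rw [hN i hi, map_zero]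
    have hK' : ∀ i, K < i → D' (M.coeff i) = 0 := fun i hi => by rw [hK i hi, map_zero]
    rw [coeff_add, coeff_mapCoeff, coeff_mul_eq_sum L M m N K hN hK _ _ subset_rfl subset_rfl,
      coeff_mul_eq_sum (mapCoeff (D' : A →+ A) L) M m N K hN' hK _ _ subset_rfl subset_rfl,
      coeff_mul_eq_sum L (mapCoeff (D' : A →+ A) M) m N K hN hK' _ _ subset_rfl subset_rfl]
    rw [AddMonoidHom.coe_coe]
    simp only [map_sum, ← Finset.sum_add_distrib, coeff_mapCoeff]
    refine Finset.sum_congr rfl fun i _ => Finset.sum_congr rfl fun j _ => ?_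
    unfold monoMul
    split_ifs
    · rw [map_zsmul, D'.leibniz, smul_add, ← D.iter_comm D' h]
      rfl
    · simp

@[simp] theorem coeff_extendDer (D' : RingDer A) (h : ∀ a, D (D' a) = D' (D a)) (L : PDO D)
    (i : ℤ) : (extendDer D' h L).coeff i = D' (L.coeff i) := rfl

end PDO

end PDO

/-- A ring with a family of commuting derivations. -/
structure DiffRing (ι : Type) where
  carrier : Type u
  [ring : Ring carrier]
  der : ι → RingDer carrier
  der_comm : ∀ (i j : ι) (a : carrier), der i (der j a) = der j (der i a)

namespace DiffRing

instance {ι : Type} (A : DiffRing.{u} ι) : Ring A.carrier := A.ring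

/-- The ring `A((∂_j⁻¹))`, on which all the derivations of `A` act coefficientwise. -/
noncomputable def adjoin {ι : Type} (A : DiffRing.{u} ι) (j : ι) : DiffRing.{u} ι where
  carrier := PDO (A.der j)
  der i := PDO.extendDer (A.der i) (A.der_comm j i)
  der_comm i i' L := by
    apply PDO.ext
    intro m
    exact A.der_comm i i' (L.coeff m)

variable {n : ℕ} (A : DiffRing.{u} (Fin n))

/-- The iterated ring `A((∂_1⁻¹))…((∂_m⁻¹))` for `m ≤ n`, with its `n` derivations. The variable
`∂_{l+1}` is the one belonging to the index `l : Fin n`. -/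
noncomputable def tower : (m : ℕ) → m ≤ n → DiffRing.{u} (Fin n)
  | 0, _ => A
  | m + 1, h => (tower m (Nat.le_of_succ_le h)).adjoin ⟨m, h⟩

/-- The ring `A((∂_1⁻¹))…((∂_n⁻¹))`. -/
abbrev Op : Type u := (A.tower n le_rfl).carrier

/-- The element `∂_{i+1}` of `A((∂_1⁻¹))…((∂_m⁻¹))`, for `i < m`: it is the monomial of degree one
at the level where it is adjoined, and a constant term at the later levels. -/
noncomputable def partialAux (i : Fin n) :
    (m : ℕ) → (h : m ≤ n) → i.val < m → (A.tower m h).carrier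
  | 0, _, hi => absurd hi (Nat.not_lt_zero _)
  | m + 1, h, _ =>
    if hm : i.val < m then
      PDO.single (D := (A.tower m (Nat.le_of_succ_le h)).der ⟨m, h⟩) 0
        (partialAux i m (Nat.le_of_succ_le h) hm)
    else
      PDO.single (D := (A.tower m (Nat.le_of_succ_le h)).der ⟨m, h⟩) 1 1

/-- The operator `∂_{i+1}` in `A((∂_1⁻¹))…((∂_n⁻¹))`. -/
noncomputable def partialOp (i : Fin n) : A.Op := A.partialAux i n le_rfl i.isLt

/-- The elements of `A((∂_1⁻¹))…((∂_m⁻¹))` all of whose coefficients lie in the subset `I` of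
`A`, that is, the elements of `I((∂_1⁻¹))…((∂_m⁻¹))`. -/
def coeffsInAux (I : Set A.carrier) : (m : ℕ) → (h : m ≤ n) → Set (A.tower m h).carrier
  | 0, _ => I
  | m + 1, h =>
    {L | ∀ i : ℤ, PDO.coeff (D := (A.tower m (Nat.le_of_succ_le h)).der ⟨m, h⟩) L i ∈
      coeffsInAux I m (Nat.le_of_succ_le h)}

/-- The elements of `A((∂_1⁻¹))…((∂_n⁻¹))` with all coefficients in the subset `I` of `A`. -/
def coeffsIn (I : Set A.carrier) : Set A.Op := A.coeffsInAux I n le_rfl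

/-- The elements of `A((∂_1⁻¹))…((∂_m⁻¹))` of negative order in the last variable `∂_m`
(only zero if there is no variable). -/
def negAux : (m : ℕ) → (h : m ≤ n) → Set (A.tower m h).carrier
  | 0, _ => {0}
  | m + 1, h =>
    {L | ∀ i : ℤ, 0 ≤ i →
      PDO.coeff (D := (A.tower m (Nat.le_of_succ_le h)).der ⟨m, h⟩) L i = 0}

/-- The operators of negative order in `∂_n`. -/
def neg : Set A.Op := A.negAux n le_rfl

end DiffRing

/-- A derivation in the sense of Mathlib, viewed as a derivation of the underlying ring. -/
def RingDer.ofDerivation {R B : Type*} [CommRing R] [CommRing B] [Algebra R B]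
    (D : Derivation R B B) : RingDer B where
  toFun b := D b
  map_zero' := D.map_zero
  map_add' := D.map_add
  leibniz' a b := by
    change D (a * b) = D a * b + a * D b
    rw [D.leibniz, smul_eq_mul, smul_eq_mul]
    ring

/-- The ring `k[[x_1, …, x_n]]` with the partial derivatives. -/
noncomputable def powerSeriesRing (n : ℕ) (k : Type u) [Field k] : DiffRing.{u} (Fin n) where
  carrier := MvPowerSeries (Fin n) k
  der i := RingDer.ofDerivation (MvPowerSeries.pderiv k i)
  der_comm i j f := by
    change MvPowerSeries.pderiv k i (MvPowerSeries.pderiv k j f) =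
      MvPowerSeries.pderiv k j (MvPowerSeries.pderiv k i f)
    ext d
    simp only [MvPowerSeries.coeff_pderiv]
    by_cases h : i = j
    · rw [h]
    · have h' : j ≠ i := fun e => h e.symm
      rw [add_right_comm]
      simp only [Finsupp.add_apply, Finsupp.single_eq_of_ne h, Finsupp.single_eq_of_ne h', add_zero]
      ring

/-- The ring of smooth real functions on `ℝⁿ`. -/
def smoothSubring (n : ℕ) : Subring (EuclideanSpace ℝ (Fin n) → ℝ) where
  carrier := {f | ContDiff ℝ ∞ f}
  mul_mem' := by
    intro f g hf hg
    exact ContDiff.mul (Set.mem_ofPred.1 hf) (Set.mem_ofPred.1 hg)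
  one_mem' := by
    exact (contDiff_const : ContDiff ℝ ∞ fun _ : EuclideanSpace ℝ (Fin n) => (1 : ℝ))
  add_mem' := by
    intro f g hf hg
    exact ContDiff.add (Set.mem_ofPred.1 hf) (Set.mem_ofPred.1 hg)
  zero_mem' := by
    exact (contDiff_const : ContDiff ℝ ∞ fun _ : EuclideanSpace ℝ (Fin n) => (0 : ℝ))
  neg_mem' := by
    intro f hf
    exact ContDiff.neg (Set.mem_ofPred.1 hf)

/-- The partial derivative of a function on `ℝⁿ` in the direction of the `i`-th coordinate. -/
noncomputable def partialDeriv {n : ℕ} (i : Fin n) (f : EuclideanSpace ℝ (Fin n) → ℝ) :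
    EuclideanSpace ℝ (Fin n) → ℝ :=
  fun x => fderiv ℝ f x (EuclideanSpace.single i 1)

theorem smooth_differentiable {n : ℕ} (f : smoothSubring n) : Differentiable ℝ f.1 :=
  ContDiff.differentiable (n := ∞) f.2 (by simp)

theorem partialDeriv_smooth {n : ℕ} (i : Fin n) (f : smoothSubring n) :
    ContDiff ℝ ∞ (partialDeriv i f.1) :=
  (ContDiff.fderiv_right (n := ∞) f.2 (by simp)).clm_apply contDiff_const

/-- The ring of smooth real functions on `ℝⁿ` with the partial derivatives. -/
noncomputable def smoothRing (n : ℕ) : DiffRing.{0} (Fin n) where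
  carrier := smoothSubring n
  der i :=
    { toFun := fun f => ⟨partialDeriv i f.1, partialDeriv_smooth i f⟩
      map_zero' := by
        apply Subtype.ext
        funext x
        simp [partialDeriv]
      map_add' := fun f g => by
        apply Subtype.ext
        funext x
        simp [partialDeriv, fderiv_add (smooth_differentiable f x) (smooth_differentiable g x)]
      leibniz' := fun f g => by
        apply Subtype.ext
        funext x
        simp [partialDeriv, fderiv_mul (smooth_differentiable f x) (smooth_differentiable g x)]
        ring }
  der_comm i j f := by
    apply Subtype.ext
    funext x
    have hd : DifferentiableAt ℝ (fderiv ℝ f.1) x :=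
      (ContDiff.fderiv_right (n := ∞) (m := ∞) f.2 (by simp)).differentiable (by simp) x
    have hs : IsSymmSndFDerivAt ℝ f.1 x :=
      ContDiffAt.isSymmSndFDerivAt (n := ∞) (ContDiff.contDiffAt f.2)
        (by
          rw [minSmoothness_of_isRCLikeNormedField]
          exact WithTop.coe_le_coe.2 (le_top : (2 : ℕ∞) ≤ ⊤))
    have h : ∀ v w : EuclideanSpace ℝ (Fin n),
        fderiv ℝ (fun y => fderiv ℝ f.1 y v) x w = fderiv ℝ (fderiv ℝ f.1) x w v := by
      intro v w
      rw [fderiv_clm_apply hd (differentiableAt_const v)]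
      simp
    change fderiv ℝ (fun y => fderiv ℝ f.1 y _) x _ = fderiv ℝ (fun y => fderiv ℝ f.1 y _) x _
    rw [h, h]
    exact hs _ _

/-- The ring `E = k[[x_1, …, x_n]]((∂_1⁻¹))…((∂_n⁻¹))`. -/
abbrev E (n : ℕ) (k : Type u) [Field k] : Type u := (powerSeriesRing n k).Op

/-- The part `E_-` of operators of negative order. -/
def EMinus (n : ℕ) (k : Type u) [Field k] : Set (E n k) := (powerSeriesRing n k).neg

/-- The subset `k((∂_1⁻¹))…((∂_n⁻¹))` of `E`. -/
def EConst (n : ℕ) (k : Type u) [Field k] : Set (E n k) :=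
  (powerSeriesRing n k).coeffsIn (Set.range (MvPowerSeries.C (σ := Fin n) (R := k)))

/-- The ring `C^∞(ℝⁿ)((∂_1⁻¹))…((∂_n⁻¹))`. -/
abbrev SmoothOp (n : ℕ) : Type := (smoothRing n).Op

/-- The subset of operators whose coefficients are rapidly decreasing, i.e. Schwartz functions. -/
def RapidOp (n : ℕ) : Set (SmoothOp n) :=
  (smoothRing n).coeffsIn {f : smoothSubring n |
    ∃ φ : SchwartzMap (EuclideanSpace ℝ (Fin n)) ℝ, ∀ x, f.1 x = φ x}

/-- The operators of negative order with rapidly decreasing coefficients. -/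
def RapidMinus (n : ℕ) : Set (SmoothOp n) := RapidOp n ∩ (smoothRing n).neg

/-- The subset `ℝ((∂_1⁻¹))…((∂_n⁻¹))` of `C^∞(ℝⁿ)((∂_1⁻¹))…((∂_n⁻¹))`. -/
def SmoothConst (n : ℕ) : Set (SmoothOp n) :=
  (smoothRing n).coeffsIn {f : smoothSubring n | ∃ c : ℝ, ∀ x, f.1 x = c}

end FormalPDO

/-!
Write `L i = ∂_i + M i` with `M i` of negative order in `∂_n`. As the commutator with `∂_i` is the
derivation `∂/∂x_i` applied to the coefficients (`DiffRing.partialAux_mul_sub`), the operators `L i`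
commute if and only if the connection `d - M` is flat, and `L i = S⁻¹ ∂_i S` for all `i` if and only
if `S` is a horizontal section, `∂S/∂x_i = S M i`. Since `M` has negative order, the last equation
expresses the differential of the coefficient of `S` at `∂_n ^ (-m)` by the coefficients at higher
powers of `∂_n`, and flatness says that the one-form to be integrated is closed
(`DiffRing.exists_gauge`, based on the successive approximation
`PDO.exists_forall_eq_zero_of_step`). So everything rests on the exactness of closed one-forms in
the ring of coefficients (`DiffRing.ClosedFormsExact`), a property inherited by the iterated rings
of operators because all derivations act coefficientwise.

For power series over a field of characteristic zero, exactness is the formal Poincaré lemma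
(`exists_pderiv_eq`). For Schwartz functions on `ℝⁿ`, the usual Poincaré lemma gives a primitive;
the rapid decay of its differential makes it converge rapidly along each ray, and for `n ≥ 2` the
limits along all rays agree because rays can be joined away from the origin. Subtracting this limit
gives a Schwartz primitive (`exists_schwartz_primitive`).

If `S` is a dressing operator then so is `S'` exactly if `S' S⁻¹` commutes with all `∂_i`, that is,
is killed by all `∂/∂x_i`, that is, has constant coefficients (`DiffRing.dressing_unique`); here one
uses that the operators `1 +` (negative order, coefficients in a given differential subring) are
closed under products and inverses.
-/

namespace FormalPDO

namespace PDO

/-! ### Filtration by order, and operators with coefficients in a subgroup -/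

variable {A : Type u} [Ring A] {D : RingDer A}

/-- The operators of order at most `N`. -/
def orderLE (D : RingDer A) (N : ℤ) : AddSubgroup (PDO D) where
  carrier := {L | ∀ i, N < i → L.coeff i = 0}
  zero_mem' := fun _ _ => rfl
  add_mem' {L M} hL hM i hi := by rw [coeff_add, hL i hi, hM i hi, add_zero]
  neg_mem' {L} hL i hi := by rw [coeff_neg, hL i hi, neg_zero]

theorem orderLE_mono {N K : ℤ} (h : N ≤ K) : orderLE D N ≤ orderLE D K :=
  fun _ hL i hi => hL i (h.trans_lt hi)

theorem mul_mem_orderLE {N K : ℤ} {L M : PDO D} (hL : L ∈ orderLE D N) (hM : M ∈ orderLE D K) :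
    L * M ∈ orderLE D (N + K) :=
  fun m hm => coeff_mul_eq_zero L M m N K hL hM hm

theorem single_mem_orderLE (i : ℤ) (a : A) : (single i a : PDO D) ∈ orderLE D i :=
  fun j hj => by rw [coeff_single, if_neg (by omega)]

theorem one_mem_orderLE : (1 : PDO D) ∈ orderLE D 0 := single_mem_orderLE 0 1

theorem mem_orderLE_zero_of_sub_one_mem {L : PDO D} (h : L - 1 ∈ orderLE D (-1)) :
    L ∈ orderLE D 0 := by
  simpa using add_mem (orderLE_mono (by norm_num) h) one_mem_orderLE

theorem mem_orderLE_sub_one {N : ℤ} {L : PDO D} (hL : L ∈ orderLE D N) (h : L.coeff N = 0) :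
    L ∈ orderLE D (N - 1) := by
  intro i hi
  rcases eq_or_lt_of_le (show N ≤ i by omega) with rfl | hi'
  · exact h
  · exact hL i hi'

theorem sub_single_mem_orderLE {N : ℤ} {L : PDO D} (hL : L ∈ orderLE D N) :
    L - single N (L.coeff N) ∈ orderLE D (N - 1) :=
  mem_orderLE_sub_one (sub_mem hL (single_mem_orderLE _ _)) (by simp [coeff_single])

theorem eq_zero_of_forall_mem_orderLE {L : PDO D} (h : ∀ N : ℕ, L ∈ orderLE D (-(N + 1))) :
    L = 0 := by
  ext i
  exact h (-i).toNat i (by omega)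

/-- The operators all of whose coefficients lie in the subgroup `J`. -/
def withCoeffs (D : RingDer A) (J : AddSubgroup A) : AddSubgroup (PDO D) where
  carrier := {L | ∀ i, L.coeff i ∈ J}
  zero_mem' := fun _ => J.zero_mem
  add_mem' hL hM i := J.add_mem (hL i) (hM i)
  neg_mem' hL i := J.neg_mem (hL i)

theorem single_mem_withCoeffs {J : AddSubgroup A} (i : ℤ) {a : A} (ha : a ∈ J) :
    (single i a : PDO D) ∈ withCoeffs D J := fun j => by
  rw [coeff_single]
  split_ifs
  exacts [ha, J.zero_mem]

theorem iter_mem {J : AddSubgroup A} (hD : ∀ a ∈ J, D a ∈ J) (k : ℕ) {a : A} (ha : a ∈ J) :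
    D.iter k a ∈ J := by
  induction k with
  | zero => exact ha
  | succ k ih => exact hD _ ih

theorem mul_mem_withCoeffs {J : AddSubgroup A} (hJ : ∀ a ∈ J, ∀ b ∈ J, a * b ∈ J)
    (hD : ∀ a ∈ J, D a ∈ J) {L M : PDO D} (hL : L ∈ withCoeffs D J) (hM : M ∈ withCoeffs D J) :
    L * M ∈ withCoeffs D J := by
  intro m
  rw [coeff_mul]
  refine finsum_induction (· ∈ J) J.zero_mem (fun _ _ => J.add_mem) fun p => ?_
  unfold monoMul
  split_ifs
  · exact J.zsmul_mem (hJ _ (hL _) _ (iter_mem hD _ (hM _))) _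
  · exact J.zero_mem

theorem extendDer_mem_orderLE (D' : RingDer A) (h : ∀ a, D (D' a) = D' (D a)) {N : ℤ} {L : PDO D}
    (hL : L ∈ orderLE D N) : extendDer D' h L ∈ orderLE D N := fun i hi => by
  rw [coeff_extendDer, hL i hi, map_zero]

/-! ### Successive approximation in the order filtration -/

/-- Successive approximation. The equations `G X i = 0` have a solution `X = 1 + (negative order)`
as soon as each approximate solution, with defects of order at most `-(N + 1)`, can be improved by
one order with a single new term of degree `-(N + 1)`: the coefficients of the corrected
operators become stationary. -/
theorem exists_forall_eq_zero_of_step {κ : Type*} (J : AddSubgroup A) (G : PDO D → κ → PDO D)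
    (hG : ∀ X Y N, X - Y ∈ orderLE D N → ∀ i, G X i - G Y i ∈ orderLE D N)
    (h0 : ∀ i, G 1 i ∈ orderLE D (-1))
    (step : ∀ X, X - 1 ∈ orderLE D (-1) → X - 1 ∈ withCoeffs D J → ∀ N : ℕ,
      (∀ i, G X i ∈ orderLE D (-(N + 1))) →
        ∃ b ∈ J, ∀ i, G (X + single (-(N + 1)) b) i ∈ orderLE D (-(N + 1) - 1)) :
    ∃ X : PDO D, X - 1 ∈ orderLE D (-1) ∧ X - 1 ∈ withCoeffs D J ∧ ∀ i, G X i = 0 := by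
  let T : ℕ → Type u := fun N => {X : PDO D // X - 1 ∈ orderLE D (-1) ∧ X - 1 ∈ withCoeffs D J ∧
    ∀ i, G X i ∈ orderLE D (-(N + 1))}
  have next : ∀ N (X : T N), ∃ Y : T (N + 1), Y.1 - X.1 ∈ orderLE D (-(N + 1)) := by
    rintro N ⟨X, h1, h2, h3⟩
    obtain ⟨b, hb, hb'⟩ := step X h1 h2 N h3
    refine ⟨⟨X + single (-(N + 1)) b, ?_, ?_, ?_⟩, ?_⟩
    · rw [add_sub_right_comm]
      exact add_mem h1 (orderLE_mono (by omega) (single_mem_orderLE _ b))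
    · rw [add_sub_right_comm]
      exact add_mem h2 (single_mem_withCoeffs _ hb)
    · intro i
      exact orderLE_mono (by push_cast; omega) (hb' i)
    · rw [add_sub_cancel_left]
      exact single_mem_orderLE _ b
  choose nxt hnxt using next
  let X0 : T 0 := ⟨1, by simp, by simp, by simpa using h0⟩
  let seq : ∀ N, T N := fun N => Nat.rec X0 (fun N X => nxt N X) N
  have hseq : ∀ N k : ℕ, (seq (N + k)).1 - (seq N).1 ∈ orderLE D (-(N + 1)) := by
    intro N k
    induction k with
    | zero => simp
    | succ k ih =>
      have := add_mem (orderLE_mono (K := -(N + 1)) (by push_cast; omega)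
        (hnxt (N + k) (seq (N + k)))) ih
      rwa [sub_add_sub_cancel] at this
  have hone : ∀ i : ℤ, -1 < i → (seq (-i).toNat).1.coeff i = (1 : PDO D).coeff i := by
    intro i hi
    rw [← sub_eq_zero]
    exact (seq (-i).toNat).2.1 i hi
  let X : PDO D := mk (fun i => (seq (-i).toNat).1.coeff i)
    ⟨0, fun i hi => by rw [hone i (by omega), coeff_one, if_neg (by omega)]⟩
  have hX : ∀ N : ℕ, X - (seq N).1 ∈ orderLE D (-(N + 1)) := by
    intro N i hi
    obtain ⟨k, hk⟩ := Nat.exists_eq_add_of_le (show (-i).toNat ≤ N by omega)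
    have := hseq (-i).toNat k i (by omega)
    rw [← hk, coeff_sub, sub_eq_zero] at this
    rw [coeff_sub, sub_eq_zero, this]
    rfl
  refine ⟨X, fun i hi => ?_, fun i => ?_, fun i => ?_⟩
  · rw [coeff_sub, sub_eq_zero]
    exact hone i hi
  · exact (seq (-i).toNat).2.2.1 i
  · refine eq_zero_of_forall_mem_orderLE fun N => ?_
    simpa using add_mem (hG _ _ _ (hX N) i) ((seq N).2.2.2 i)

/-- Operators in `1 +` (negative order, coefficients in `J`) have right inverses of the same
kind. -/
theorem exists_mul_eq_one {J : AddSubgroup A} (hJ : ∀ a ∈ J, ∀ b ∈ J, a * b ∈ J)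
    (hD : ∀ a ∈ J, D a ∈ J) {S : PDO D} (h1 : S - 1 ∈ orderLE D (-1))
    (h2 : S - 1 ∈ withCoeffs D J) :
    ∃ T : PDO D, T - 1 ∈ orderLE D (-1) ∧ T - 1 ∈ withCoeffs D J ∧ S * T = 1 := by
  have hS := mem_orderLE_zero_of_sub_one_mem h1
  obtain ⟨T, hT1, hT2, hT⟩ := exists_forall_eq_zero_of_step J (fun X (_ : Unit) => 1 - S * X)
    (fun X Y N h _ => by
      have e : (1 - S * X) - (1 - S * Y) = -(S * (X - Y)) := by noncomm_ring
      rw [e]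
      simpa using neg_mem (mul_mem_orderLE hS h))
    (fun _ => by simpa using neg_mem h1)
    (fun X _ hX N h => by
      refine ⟨(1 - S * X).coeff (-(N + 1)), ?_, fun _ => ?_⟩
      · have e : 1 - S * X = -((S - 1) + (X - 1) + (S - 1) * (X - 1)) := by noncomm_ring
        have : 1 - S * X ∈ withCoeffs D J := by
          rw [e]
          exact neg_mem (add_mem (add_mem h2 hX) (mul_mem_withCoeffs hJ hD h2 hX))
        exact this _
      · set b := (1 - S * X).coeff (-(N + 1)) with hb
        have e : 1 - S * (X + single (-(N + 1)) b) =
            (1 - S * X - single (-(N + 1)) b) - (S - 1) * single (-(N + 1)) b := by noncomm_ring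
        rw [e]
        refine sub_mem (sub_single_mem_orderLE (h ())) ?_
        exact orderLE_mono (by omega) (mul_mem_orderLE h1 (single_mem_orderLE _ b)))
  exact ⟨T, hT1, hT2, (sub_eq_zero.1 (hT ())).symm⟩

/-- The inverse of a unit in `1 +` (negative order, coefficients in `J`) is of the same kind. -/
theorem inv_sub_one_mem {J : AddSubgroup A} (hJ : ∀ a ∈ J, ∀ b ∈ J, a * b ∈ J)
    (hD : ∀ a ∈ J, D a ∈ J) {S : (PDO D)ˣ} (h1 : (S : PDO D) - 1 ∈ orderLE D (-1))
    (h2 : (S : PDO D) - 1 ∈ withCoeffs D J) :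
    (↑S⁻¹ : PDO D) - 1 ∈ orderLE D (-1) ∧ (↑S⁻¹ : PDO D) - 1 ∈ withCoeffs D J := by
  obtain ⟨T, hT1, hT2, hT⟩ := exists_mul_eq_one hJ hD h1 h2
  rw [Units.inv_eq_of_mul_eq_one_right hT]
  exact ⟨hT1, hT2⟩

theorem mul_sub_one_mem {J : AddSubgroup A} (hJ : ∀ a ∈ J, ∀ b ∈ J, a * b ∈ J)
    (hD : ∀ a ∈ J, D a ∈ J) {S T : PDO D} (hS1 : S - 1 ∈ orderLE D (-1))
    (hS2 : S - 1 ∈ withCoeffs D J) (hT1 : T - 1 ∈ orderLE D (-1))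
    (hT2 : T - 1 ∈ withCoeffs D J) :
    S * T - 1 ∈ orderLE D (-1) ∧ S * T - 1 ∈ withCoeffs D J := by
  have e : S * T - 1 = (S - 1) + (T - 1) + (S - 1) * (T - 1) := by noncomm_ring
  rw [e]
  exact ⟨add_mem (add_mem hS1 hT1) (orderLE_mono (by norm_num) (mul_mem_orderLE hS1 hT1)),
    add_mem (add_mem hS2 hT2) (mul_mem_withCoeffs hJ hD hS2 hT2)⟩

/-- Operators in `1 +` (negative order, coefficients in `J`) are invertible. -/
theorem isUnit_of_sub_one_mem {J : AddSubgroup A} (hJ : ∀ a ∈ J, ∀ b ∈ J, a * b ∈ J)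
    (hD : ∀ a ∈ J, D a ∈ J) {S : PDO D} (h1 : S - 1 ∈ orderLE D (-1))
    (h2 : S - 1 ∈ withCoeffs D J) : IsUnit S := by
  obtain ⟨T, hT1, hT2, hT⟩ := exists_mul_eq_one hJ hD h1 h2
  obtain ⟨R, -, -, hR⟩ := exists_mul_eq_one hJ hD hT1 hT2
  exact ⟨⟨S, T, hT, by rw [left_inv_eq_right_inv hT hR, hR]⟩, rfl⟩

/-! ### Multiplication by monomials -/

theorem coeff_single_zero_mul (b : A) (L : PDO D) (m : ℤ) :
    (single 0 b * L).coeff m = b * L.coeff m := by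
  obtain ⟨N, hN⟩ := L.bounded
  rw [coeff_single_mul 0 b L m N hN (insert m (Finset.Icc (m - 0) N)) (Finset.subset_insert _ _),
    Finset.sum_eq_single m]
  · rw [monoMul_nat D 0 m m _ _ 0 (by simp)]
    simp
  · intro j _ hj
    rcases lt_or_ge (0 + j) m with h | h
    · exact monoMul_of_lt D _ _ _ _ _ h
    · rw [monoMul_nat D 0 j m _ _ (j - m).toNat (by omega),
        Ring.choose_zero_pos ℤ (by omega : 0 < (j - m).toNat), zero_smul]
  · simp

theorem coeff_single_one_one_mul (L : PDO D) (m : ℤ) :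
    (single 1 1 * L).coeff m = L.coeff (m - 1) + D (L.coeff m) := by
  obtain ⟨N, hN⟩ := L.bounded
  rw [coeff_single_mul 1 1 L m N hN (insert (m - 1) (insert m (Finset.Icc (m - 1) N)))
    ((Finset.subset_insert _ _).trans (Finset.subset_insert _ _)),
    Finset.sum_eq_add_of_mem (m - 1) m (by simp) (by simp) (by omega)]
  · rw [monoMul_nat D 1 (m - 1) m _ _ 0 (by simp), monoMul_nat D 1 m m _ _ 1 (by push_cast; ring)]
    simp [RingDer.iter_succ]
  · rintro j _ ⟨hj1, hj2⟩
    rcases lt_or_ge (1 + j) m with h | h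
    · exact monoMul_of_lt D _ _ _ _ _ h
    · have hc : Ring.choose (1 : ℤ) (1 + j - m).toNat = 0 := by
        have := Ring.choose_natCast (R := ℤ) 1 (1 + j - m).toNat
        rw [Nat.cast_one] at this
        rw [this, Nat.choose_eq_zero_of_lt (by omega), Nat.cast_zero]
      rw [monoMul_nat D 1 j m _ _ (1 + j - m).toNat (by omega), hc, zero_smul]

/-- Right multiplication by a monomial with constant coefficient shifts the coefficients. -/
theorem coeff_mul_single (L : PDO D) (l : ℤ) {b : A} (hb : D b = 0) (m : ℤ) :
    (L * single l b).coeff m = L.coeff (m - l) * b := by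
  obtain ⟨N, hN⟩ := L.bounded
  have hk : ∀ k : ℕ, k ≠ 0 → D.iter k b = 0 := by
    intro k hk
    obtain ⟨k, rfl⟩ := Nat.exists_eq_succ_of_ne_zero hk
    induction k with
    | zero => simpa [RingDer.iter_succ] using hb
    | succ k ih => rw [Nat.succ_eq_add_one, RingDer.iter_succ, ih (Nat.succ_ne_zero k), map_zero]
  rw [coeff_mul_eq_sum L (single l b) m N l hN (fun j hj => if_neg (by omega))
    (insert (m - l) (Finset.Icc (m - l) N)) (insert l (Finset.Icc (m - N) l))
    (Finset.subset_insert _ _) (Finset.subset_insert _ _), Finset.sum_eq_single (m - l)]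
  · rw [Finset.sum_eq_single l]
    · rw [monoMul_nat D (m - l) l m _ _ 0 (by simp)]
      simp [coeff_single]
    · intro j _ hj
      simp [coeff_single, hj]
    · simp
  · intro i _ hi
    refine Finset.sum_eq_zero fun j _ => ?_
    by_cases hj : j = l
    · subst hj
      rcases lt_or_ge (i + j) m with h | h
      · exact monoMul_of_lt D _ _ _ _ _ h
      · rw [monoMul_nat D i j m _ _ (i + j - m).toNat (by omega), coeff_single, if_pos rfl,
          hk _ (by omega), mul_zero, smul_zero]
    · simp [coeff_single, hj]
  · simp

end PDO

namespace DiffRing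

/-! ### Differential subrings and closed one-forms -/

section Forms

variable {ι : Type} (A : DiffRing.{u} ι) (J : AddSubgroup A.carrier)

/-- `J` is closed under products and under all the derivations (it need not contain `1`). -/
structure IsDiffSubring : Prop where
  mul_mem : ∀ a ∈ J, ∀ b ∈ J, a * b ∈ J
  der_mem : ∀ i, ∀ a ∈ J, A.der i a ∈ J

/-- Every closed one-form `∑ F i dx_i` with coefficients in `J` is the differential of an element
of `J`. -/
def ClosedFormsExact : Prop :=
  ∀ F : ι → A.carrier, (∀ i, F i ∈ J) → (∀ i j, A.der i (F j) = A.der j (F i)) →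
    ∃ s ∈ J, ∀ i, A.der i s = F i

/-- The elements killed by all the derivations. -/
def constants : AddSubgroup A.carrier where
  carrier := {a | ∀ i, A.der i a = 0}
  zero_mem' i := map_zero _
  add_mem' ha hb i := by rw [map_add, ha i, hb i, add_zero]
  neg_mem' ha i := by rw [map_neg, ha i, neg_zero]

variable {A J}

theorem IsDiffSubring.adjoin (h : A.IsDiffSubring J) (j : ι) :
    (A.adjoin j).IsDiffSubring (PDO.withCoeffs (A.der j) J) where
  mul_mem _ hL _ hM := PDO.mul_mem_withCoeffs h.mul_mem (h.der_mem j) hL hM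
  der_mem i _ hL m := h.der_mem i _ (hL m)

theorem ClosedFormsExact.adjoin [Finite ι] (h : A.ClosedFormsExact J) (j : ι) :
    (A.adjoin j).ClosedFormsExact (PDO.withCoeffs (A.der j) J) := by
  intro F hF hc
  -- The primitive of the zero form is taken to be zero, so that the coefficientwise primitive
  -- has coefficients bounded above.
  have key : ∀ m : ℤ, ∃ s ∈ J, (∀ i, A.der i s = PDO.coeff (D := A.der j) (F i) m) ∧
      ((∀ i, PDO.coeff (D := A.der j) (F i) m = 0) → s = 0) := by
    intro m
    by_cases h0 : ∀ i, PDO.coeff (D := A.der j) (F i) m = 0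
    · exact ⟨0, J.zero_mem, fun i => by rw [map_zero, h0 i], fun _ => rfl⟩
    · obtain ⟨s, hs, hs'⟩ := h (fun i => PDO.coeff (D := A.der j) (F i) m) (fun i => hF i m)
        (fun i i' => congrArg (fun L : PDO (A.der j) => L.coeff m) (hc i i'))
      exact ⟨s, hs, hs', fun h1 => absurd h1 h0⟩
  choose s hs hs' hs0 using key
  choose N hN using fun i => PDO.bounded (D := A.der j) (F i)
  obtain ⟨K, hK⟩ := (Set.finite_range N).bddAbove
  refine ⟨PDO.mk (D := A.der j) s ⟨K, fun m hm => hs0 m fun i => hN i m ?_⟩, hs, fun i => ?_⟩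
  · exact (hK ⟨i, rfl⟩).trans_lt hm
  · apply PDO.ext
    intro m
    exact hs' m i

end Forms

/-! ### Trivializing a flat connection of negative order -/

section Gauge

variable {ι : Type} {A : DiffRing.{u} ι} {J : AddSubgroup A.carrier}

/-- The derivation `A.der i`, extended to `A((∂_j⁻¹))`. -/
noncomputable abbrev extDer (A : DiffRing.{u} ι) (j i : ι) : RingDer (PDO (A.der j)) :=
  PDO.extendDer (A.der i) (A.der_comm j i)

/-- A flat connection `d - M` with `M` of negative order has a horizontal section `S`
of the form `1 +` (negative order). As `M` has negative order, the equation `d S = S M`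
determines the differential of each coefficient of `S` by the preceding ones, and flatness of `M`
makes this one-form closed. -/
theorem exists_gauge (hJ : A.IsDiffSubring J) (hF : A.ClosedFormsExact J) (j : ι)
    (M : ι → PDO (A.der j)) (hM1 : ∀ i, M i ∈ PDO.orderLE (A.der j) (-1))
    (hM2 : ∀ i, M i ∈ PDO.withCoeffs (A.der j) J)
    (hflat : ∀ i l, A.extDer j i (M l) - A.extDer j l (M i) + (M i * M l - M l * M i) = 0) :
    ∃ S : PDO (A.der j), S - 1 ∈ PDO.orderLE (A.der j) (-1) ∧
      S - 1 ∈ PDO.withCoeffs (A.der j) J ∧ ∀ i, A.extDer j i S = S * M i := by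
  refine Exists.imp (fun S hS => ⟨hS.1, hS.2.1, fun i => (sub_eq_zero.1 (hS.2.2 i)).symm⟩)
    (PDO.exists_forall_eq_zero_of_step J (fun X (i : ι) => X * M i - A.extDer j i X) ?_ ?_ ?_)
  · intro X Y N h i
    have e : (X * M i - A.extDer j i X) - (Y * M i - A.extDer j i Y) =
        (X - Y) * M i - A.extDer j i (X - Y) := by
      rw [map_sub]
      noncomm_ring
    rw [e]
    exact sub_mem (PDO.orderLE_mono (by omega) (PDO.mul_mem_orderLE h (hM1 i)))
      (PDO.extendDer_mem_orderLE _ _ h)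
  · intro i
    simpa [RingDer.map_one] using hM1 i
  · intro X hX1 hX2 N hN
    set W : ι → PDO (A.der j) := fun i => X * M i - A.extDer j i X with hW
    have hd : ∀ i, A.extDer j i X = X * M i - W i := fun i => by rw [hW]; noncomm_ring
    have hdd : ∀ i l, A.extDer j i (A.extDer j l X) = A.extDer j l (A.extDer j i X) :=
      fun i l => (A.adjoin j).der_comm i l X
    have hWJ : ∀ i, (W i).coeff (-(N + 1)) ∈ J := by
      intro i
      have e : W i = M i + (X - 1) * M i - A.extDer j i (X - 1) := by
        rw [map_sub, RingDer.map_one, hd]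
        noncomm_ring
      have : W i ∈ PDO.withCoeffs (A.der j) J := by
        rw [e]
        exact sub_mem (add_mem (hM2 i) (PDO.mul_mem_withCoeffs hJ.mul_mem (hJ.der_mem j) hX2
          (hM2 i))) ((hJ.adjoin j).der_mem i _ hX2)
      exact this _
    have hWc : ∀ i l, A.der i ((W l).coeff (-(N + 1))) = A.der l ((W i).coeff (-(N + 1))) := by
      intro i l
      have e : A.extDer j i (W l) - A.extDer j l (W i) = W l * M i - W i * M l := by
        have h1 : ∀ i l, A.extDer j i (W l) = (X * M i - W i) * M l + X * A.extDer j i (M l) -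
            A.extDer j i (A.extDer j l X) := fun i l => by
          rw [← hd i, ← RingDer.leibniz, ← map_sub]
        have h2 : A.extDer j i (M l) = A.extDer j l (M i) - (M i * M l - M l * M i) := by
          rw [← sub_eq_zero, ← hflat i l]
          noncomm_ring
        rw [h1 i l, h1 l i, hdd i l, h2]
        noncomm_ring
      have hm : W l * M i - W i * M l ∈ PDO.orderLE (A.der j) (-(N + 1) + -1) :=
        sub_mem (PDO.mul_mem_orderLE (hN l) (hM1 i)) (PDO.mul_mem_orderLE (hN i) (hM1 l))
      rw [← e] at hm
      have := hm (-(N + 1)) (by omega)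
      rwa [PDO.coeff_sub, PDO.coeff_extendDer, PDO.coeff_extendDer, sub_eq_zero] at this
    obtain ⟨b, hb, hb'⟩ := hF (fun i => (W i).coeff (-(N + 1))) hWJ hWc
    refine ⟨b, hb, fun i => ?_⟩
    have e : (X + PDO.single (-(N + 1)) b) * M i -
        A.extDer j i (X + PDO.single (-(N + 1)) b) =
        (W i - A.extDer j i (PDO.single (-(N + 1)) b)) + PDO.single (-(N + 1)) b * M i := by
      rw [map_add, hd]
      noncomm_ring
    rw [e]
    refine add_mem (PDO.mem_orderLE_sub_one (sub_mem (hN i) (PDO.extendDer_mem_orderLE _ _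
      (PDO.single_mem_orderLE _ _))) ?_) (PDO.orderLE_mono (by omega)
        (PDO.mul_mem_orderLE (PDO.single_mem_orderLE _ _) (hM1 i)))
    rw [PDO.coeff_sub, PDO.coeff_extendDer, PDO.coeff_single, if_pos rfl, hb', sub_self]

end Gauge

/-! ### The iterated ring -/

section Tower

variable {n : ℕ} (A : DiffRing.{u} (Fin n))

/-- The additive subgroup of `A((∂_1⁻¹))…((∂_m⁻¹))` with underlying set `A.coeffsInAux J m h`. -/
noncomputable def coeffsSub (J : AddSubgroup A.carrier) : (m : ℕ) → (h : m ≤ n) →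
    AddSubgroup (A.tower m h).carrier
  | 0, _ => J
  | m + 1, h => PDO.withCoeffs ((A.tower m (Nat.le_of_succ_le h)).der ⟨m, h⟩)
      (coeffsSub J m (Nat.le_of_succ_le h))

variable {A} {J : AddSubgroup A.carrier}

theorem mem_coeffsSub_iff {I : Set A.carrier} (hI : ∀ a, a ∈ J ↔ a ∈ I) (m : ℕ) (h : m ≤ n)
    (L : (A.tower m h).carrier) : L ∈ A.coeffsSub J m h ↔ L ∈ A.coeffsInAux I m h := by
  induction m with
  | zero => exact hI L
  | succ m ih => exact forall_congr' fun i => ih _ _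

theorem IsDiffSubring.tower (hJ : A.IsDiffSubring J) (m : ℕ) (h : m ≤ n) :
    (A.tower m h).IsDiffSubring (A.coeffsSub J m h) := by
  induction m with
  | zero => exact hJ
  | succ m ih => exact (ih _).adjoin _

theorem ClosedFormsExact.tower (hJ : A.ClosedFormsExact J) (m : ℕ) (h : m ≤ n) :
    (A.tower m h).ClosedFormsExact (A.coeffsSub J m h) := by
  induction m with
  | zero => exact hJ
  | succ m ih => exact (ih _).adjoin _

theorem coeffsSub_constants (m : ℕ) (h : m ≤ n) :
    A.coeffsSub A.constants m h = (A.tower m h).constants := by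
  induction m with
  | zero => rfl
  | succ m ih =>
    set D := (A.tower m (Nat.le_of_succ_le h)).der ⟨m, h⟩
    ext L
    change (∀ i, _ ∈ A.coeffsSub A.constants m _) ↔ _
    simp only [ih]
    exact ⟨fun hL i => PDO.ext (D := D) fun l => hL l i,
      fun hL l i => congrArg (fun P => PDO.coeff (D := D) P l) (hL i)⟩

theorem partialAux_of_lt (i : Fin n) (m : ℕ) (h : m + 1 ≤ n) (hi : i.val < m + 1)
    (hm : i.val < m) :
    A.partialAux i (m + 1) h hi =
      (PDO.single 0 (A.partialAux i m (Nat.le_of_succ_le h) hm) :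
        PDO ((A.tower m (Nat.le_of_succ_le h)).der ⟨m, h⟩)) :=
  dif_pos hm

theorem partialAux_of_not_lt (i : Fin n) (m : ℕ) (h : m + 1 ≤ n) (hi : i.val < m + 1)
    (hm : ¬ i.val < m) :
    A.partialAux i (m + 1) h hi =
      (PDO.single 1 1 : PDO ((A.tower m (Nat.le_of_succ_le h)).der ⟨m, h⟩)) :=
  dif_neg hm

theorem der_partialAux (i l : Fin n) (m : ℕ) (h : m ≤ n) (hi : i.val < m) :
    (A.tower m h).der l (A.partialAux i m h hi) = 0 := by
  induction m with
  | zero => exact absurd hi (Nat.not_lt_zero _)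
  | succ m ih =>
    have hs : ∀ (j : ℤ) (b : (A.tower m (Nat.le_of_succ_le h)).carrier),
        (A.tower m (Nat.le_of_succ_le h)).der l b = 0 →
        (A.tower (m + 1) h).der l
          (PDO.single (D := (A.tower m (Nat.le_of_succ_le h)).der ⟨m, h⟩) j b) = 0 := by
      intro j b hb
      apply PDO.ext (D := (A.tower m (Nat.le_of_succ_le h)).der ⟨m, h⟩)
      intro p
      change (A.tower m (Nat.le_of_succ_le h)).der l (if p = j then b else 0) = 0
      split_ifs
      exacts [hb, map_zero _]
    by_cases hm : i.val < m
    · rw [partialAux_of_lt i m h hi hm]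
      exact hs _ _ (ih _ hm)
    · rw [partialAux_of_not_lt i m h hi hm]
      exact hs _ _ (RingDer.map_one _)

/-- The commutator with `∂_i` is the coefficientwise derivation. -/
theorem partialAux_mul_sub (i : Fin n) (m : ℕ) (h : m ≤ n) (hi : i.val < m)
    (L : (A.tower m h).carrier) :
    A.partialAux i m h hi * L - L * A.partialAux i m h hi = (A.tower m h).der i L := by
  induction m with
  | zero => exact absurd hi (Nat.not_lt_zero _)
  | succ m ih =>
    set D := (A.tower m (Nat.le_of_succ_le h)).der ⟨m, h⟩ with hD
    apply PDO.ext (D := D)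
    intro l
    by_cases hm : i.val < m
    · rw [partialAux_of_lt i m h hi hm]
      have h1 := PDO.coeff_single_zero_mul (D := D) (A.partialAux i m (Nat.le_of_succ_le h) hm) L l
      have h2 := PDO.coeff_mul_single (D := D) L 0 (der_partialAux i ⟨m, h⟩ m _ hm) l
      rw [sub_zero] at h2
      exact (congrArg₂ (· - ·) h1 h2).trans (ih _ hm _)
    · rw [partialAux_of_not_lt i m h hi hm]
      have him : i = ⟨m, h⟩ := Fin.ext (by simp only; omega)
      have h1 := PDO.coeff_single_one_one_mul (D := D) L l
      have h2 := PDO.coeff_mul_single (D := D) L 1 (RingDer.map_one _) l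
      rw [mul_one] at h2
      rw [← h2, ← sub_eq_iff_eq_add'] at h1
      rw [him]
      exact h1

end Tower

/-! ### Dressing operators -/

section Dressing

variable {n : ℕ} (A : DiffRing.{u} (Fin n)) (J : AddSubgroup A.carrier)

/-- The operators of negative order in `∂_n` with all coefficients in `J`. -/
def negWith : Set A.Op := {L | L ∈ A.coeffsSub J n le_rfl} ∩ A.neg

variable {A J}

theorem mem_negWith_succ {m : ℕ} {A : DiffRing.{u} (Fin (m + 1))} {J : AddSubgroup A.carrier}
    (L : PDO ((A.tower m (Nat.le_succ m)).der ⟨m, m.lt_succ_self⟩)) :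
    (show A.Op from L) ∈ A.negWith J ↔
      L ∈ PDO.orderLE _ (-1) ∧ L ∈ PDO.withCoeffs _ (A.coeffsSub J m (Nat.le_succ m)) :=
  ⟨fun h => ⟨fun i hi => h.2 i (by omega), h.1⟩, fun h => ⟨h.2, fun i hi => h.1 i (by omega)⟩⟩

theorem inv_sub_one_mem_negWith (hn : 1 ≤ n) (hJ : A.IsDiffSubring J) {S : A.Opˣ}
    (hS : (S : A.Op) - 1 ∈ A.negWith J) : (↑S⁻¹ : A.Op) - 1 ∈ A.negWith J := by
  obtain ⟨m, rfl⟩ : ∃ m, n = m + 1 := ⟨n - 1, by omega⟩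
  have hJm := hJ.tower m (Nat.le_succ m)
  have h := (mem_negWith_succ _).1 hS
  exact (mem_negWith_succ _).2 (PDO.inv_sub_one_mem hJm.mul_mem (hJm.der_mem _) h.1 h.2)

theorem mul_sub_one_mem_negWith (hn : 1 ≤ n) (hJ : A.IsDiffSubring J) {S T : A.Op}
    (hS : S - 1 ∈ A.negWith J) (hT : T - 1 ∈ A.negWith J) : S * T - 1 ∈ A.negWith J := by
  obtain ⟨m, rfl⟩ : ∃ m, n = m + 1 := ⟨n - 1, by omega⟩
  have hJm := hJ.tower m (Nat.le_succ m)
  have h := (mem_negWith_succ _).1 hS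
  have h' := (mem_negWith_succ _).1 hT
  exact (mem_negWith_succ _).2
    (PDO.mul_sub_one_mem hJm.mul_mem (hJm.der_mem _) h.1 h.2 h'.1 h'.2)

/-- A flat connection `d - M` with `M` of negative order is gauge equivalent to `d`. -/
theorem exists_unit_gauge (hn : 1 ≤ n) (hJ : A.IsDiffSubring J) (hF : A.ClosedFormsExact J)
    (M : Fin n → A.Op) (hM : ∀ i, M i ∈ A.negWith J)
    (hflat : ∀ i l, (A.tower n le_rfl).der i (M l) - (A.tower n le_rfl).der l (M i) +
      (M i * M l - M l * M i) = 0) :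
    ∃ S : A.Opˣ, (S : A.Op) - 1 ∈ A.negWith J ∧
      ∀ i, (A.tower n le_rfl).der i S = S * M i := by
  obtain ⟨m, rfl⟩ : ∃ m, n = m + 1 := ⟨n - 1, by omega⟩
  have hJm := hJ.tower m (Nat.le_succ m)
  obtain ⟨S, hS1, hS2, hS⟩ := exists_gauge hJm (hF.tower m (Nat.le_succ m)) ⟨m, m.lt_succ_self⟩ M
    (fun i => ((mem_negWith_succ _).1 (hM i)).1) (fun i => ((mem_negWith_succ _).1 (hM i)).2) hflat
  obtain ⟨T, rfl⟩ := PDO.isUnit_of_sub_one_mem hJm.mul_mem (hJm.der_mem _) hS1 hS2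
  exact ⟨T, (mem_negWith_succ _).2 ⟨hS1, hS2⟩, hS⟩

theorem der_partialOp (i l : Fin n) : (A.tower n le_rfl).der l (A.partialOp i) = 0 :=
  der_partialAux i l n le_rfl i.isLt

theorem partialOp_mul_sub (i : Fin n) (L : A.Op) :
    A.partialOp i * L - L * A.partialOp i = (A.tower n le_rfl).der i L :=
  partialAux_mul_sub i n le_rfl i.isLt L

theorem partialOp_mul (i : Fin n) (L : A.Op) :
    A.partialOp i * L = L * A.partialOp i + (A.tower n le_rfl).der i L := by
  rw [← partialOp_mul_sub, add_sub_cancel]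

theorem partialOp_comm (i l : Fin n) :
    A.partialOp i * A.partialOp l = A.partialOp l * A.partialOp i := by
  rw [partialOp_mul, der_partialOp, add_zero]

/-- Commuting operators `L i = ∂_i + M i` with `M i` of negative order are conjugate to the `∂_i`:
that the `L i` commute means that the connection `d - M` is flat, and `S` conjugates `L i` to
`∂_i` exactly if it is horizontal. -/
theorem exists_dressing (hn : 1 ≤ n) (hJ : A.IsDiffSubring J) (hF : A.ClosedFormsExact J)
    {L : Fin n → A.Op} (hL : ∀ i, L i - A.partialOp i ∈ A.negWith J)
    (hc : ∀ i j, L i * L j - L j * L i = 0) :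
    ∃ S : A.Opˣ, (S : A.Op) - 1 ∈ A.negWith J ∧ ∀ i, L i = ↑S⁻¹ * A.partialOp i * ↑S := by
  obtain ⟨S, hS1, hS⟩ := exists_unit_gauge hn hJ hF _ hL (fun i l => by
    rw [← partialOp_mul_sub, ← partialOp_mul_sub, ← hc i l]
    rw [← sub_eq_zero, ← sub_eq_zero.2 (partialOp_comm l i)]
    noncomm_ring)
  refine ⟨S, hS1, fun i => ?_⟩
  rw [mul_assoc, Units.eq_inv_mul_iff_mul_eq, partialOp_mul, hS, mul_sub, add_sub_cancel]

theorem comm_of_dressing {L : Fin n → A.Op} {S : A.Opˣ}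
    (hS : ∀ i, L i = ↑S⁻¹ * A.partialOp i * ↑S) (i j : Fin n) : L i * L j - L j * L i = 0 := by
  have h : ∀ i j, L i * L j = ↑S⁻¹ * (A.partialOp i * A.partialOp j) * ↑S := fun i j => by
    rw [hS i, hS j]
    simp only [mul_assoc, Units.mul_inv_cancel_left]
  rw [h, h, partialOp_comm, sub_self]

/-- Two units conjugate the `∂_i` to the same operators if and only if their quotient has constant
coefficients. -/
theorem conj_eq_iff (S S' : A.Opˣ) :
    (∀ i, (↑S⁻¹ * A.partialOp i * ↑S : A.Op) = ↑S'⁻¹ * A.partialOp i * ↑S') ↔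
      (↑S' * ↑S⁻¹ : A.Op) ∈ (A.tower n le_rfl).constants := by
  refine forall_congr' fun i => ?_
  rw [← partialOp_mul_sub, sub_eq_zero, mul_assoc (↑S'⁻¹ : A.Op), Units.eq_inv_mul_iff_mul_eq,
    ← mul_assoc, ← mul_assoc, ← Units.eq_mul_inv_iff_mul_eq, ← mul_assoc, eq_comm]

/-- The dressing operator is unique up to left multiplication by an operator with constant
coefficients. -/
theorem dressing_unique (hn : 1 ≤ n) (hJ : A.IsDiffSubring J) {L : Fin n → A.Op} {S S' : A.Opˣ}
    (hS1 : (S : A.Op) - 1 ∈ A.negWith J) (hS : ∀ i, L i = ↑S⁻¹ * A.partialOp i * ↑S) :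
    ((S' : A.Op) - 1 ∈ A.negWith J ∧ ∀ i, L i = ↑S'⁻¹ * A.partialOp i * ↑S') ↔
      (↑S' * ↑S⁻¹ : A.Op) - 1 ∈ A.coeffsSub A.constants n le_rfl ∧
        (↑S' * ↑S⁻¹ : A.Op) - 1 ∈ A.negWith J := by
  have h1 : (1 : A.Op) ∈ (A.tower n le_rfl).constants := fun i => RingDer.map_one _
  have hc := conj_eq_iff S S'
  rw [coeffsSub_constants, sub_eq_add_neg (↑S' * ↑S⁻¹ : A.Op), add_mem_cancel_right (neg_mem h1),
    ← sub_eq_add_neg, ← hc]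
  simp only [hS, and_comm (a := _ ∈ A.negWith J)]
  refine and_congr_right fun _ => ⟨fun h => ?_, fun h => ?_⟩
  · exact mul_sub_one_mem_negWith hn hJ h (inv_sub_one_mem_negWith hn hJ hS1)
  · simpa using mul_sub_one_mem_negWith hn hJ h hS1

end Dressing

end DiffRing

/-! ### Functions with rapidly decreasing differential -/

section Decay

open Filter Topology

variable {E : Type*} [NormedAddCommGroup E] [NormedSpace ℝ E] {s : E → ℝ}

theorem norm_sub_le_of_decay {φ : SchwartzMap E (E →L[ℝ] ℝ)} (hs : ∀ x, HasFDerivAt s (φ x) x)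
    (N : ℕ) : ∃ C : ℝ, 0 ≤ C ∧ ∀ (x y : E) (δ : ℝ), 0 < δ → (∀ z ∈ segment ℝ x y, δ ≤ ‖z‖) →
      ‖s y - s x‖ ≤ C / δ ^ N * ‖y - x‖ := by
  obtain ⟨C, hC0, hC⟩ := φ.decay N 0
  refine ⟨C, hC0.le, fun x y δ hδ hz => ?_⟩
  refine (convex_segment x y).norm_image_sub_le_of_norm_hasFDerivWithin_le
    (fun z _ => (hs z).hasFDerivWithinAt) (fun z hzs => ?_) (left_mem_segment ℝ x y)
    (right_mem_segment ℝ x y)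
  rw [le_div_iff₀ (by positivity), mul_comm]
  have := hC z
  rw [norm_iteratedFDeriv_zero] at this
  exact (mul_le_mul_of_nonneg_right (pow_le_pow_left₀ hδ.le (hz z hzs) N) (norm_nonneg _)).trans this

theorem norm_two_smul_sub_le_of_decay {φ : SchwartzMap E (E →L[ℝ] ℝ)}
    (hs : ∀ x, HasFDerivAt s (φ x) x) (N : ℕ) :
    ∃ C : ℝ, 0 ≤ C ∧ ∀ x : E, x ≠ 0 → ‖s ((2 : ℝ) • x) - s x‖ ≤ C / ‖x‖ ^ N := by
  obtain ⟨C, hC0, hC⟩ := norm_sub_le_of_decay hs (N + 1)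
  refine ⟨C, hC0, fun x hx => ?_⟩
  have hx' : 0 < ‖x‖ := norm_pos_iff.2 hx
  refine (hC x ((2 : ℝ) • x) ‖x‖ hx' ?_).trans (le_of_eq ?_)
  · rintro z ⟨a, b, ha, hb, hab, rfl⟩
    rw [smul_smul, ← add_smul, norm_smul, Real.norm_of_nonneg (by positivity)]
    exact le_mul_of_one_le_left hx'.le (by linarith)
  · rw [two_smul, add_sub_cancel_right]
    field_simp
    ring

/-- Along the dyadic points of a ray, a function with rapidly decreasing differential converges
rapidly. -/
theorem norm_sub_limit_le_of_decay {φ : SchwartzMap E (E →L[ℝ] ℝ)}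
    (hs : ∀ x, HasFDerivAt s (φ x) x) (N : ℕ) :
    ∃ C : ℝ, 0 ≤ C ∧ ∀ x : E, x ≠ 0 → CauchySeq (fun k : ℕ => s ((2 : ℝ) ^ k • x)) ∧
      ∀ c, Tendsto (fun k : ℕ => s ((2 : ℝ) ^ k • x)) atTop (𝓝 c) →
        ‖x‖ ^ (N + 1) * ‖s x - c‖ ≤ C := by
  obtain ⟨C, hC0, hC⟩ := norm_two_smul_sub_le_of_decay hs (N + 1)
  refine ⟨2 * C, by positivity, fun x hx => ?_⟩
  have hx' : 0 < ‖x‖ := norm_pos_iff.2 hx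
  have h : ∀ k : ℕ, dist (s ((2 : ℝ) ^ k • x)) (s ((2 : ℝ) ^ (k + 1) • x)) ≤
      2 * C / ‖x‖ ^ (N + 1) / 2 / 2 ^ k := by
    intro k
    rw [dist_comm, dist_eq_norm, pow_succ', mul_smul]
    refine (hC _ (smul_ne_zero (by positivity) hx)).trans ?_
    rw [norm_smul, norm_pow, Real.norm_ofNat, mul_pow, mul_div_assoc, mul_div_cancel_left₀ _ two_ne_zero,
      div_div, mul_comm (‖x‖ ^ (N + 1))]
    have h2 : (2 : ℝ) ^ k ≤ ((2 : ℝ) ^ k) ^ (N + 1) :=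
      le_self_pow₀ (one_le_pow₀ one_le_two) (Nat.succ_ne_zero N)
    gcongr
  refine ⟨cauchySeq_of_le_geometric_two h, fun c hc => ?_⟩
  have := dist_le_of_le_geometric_two_of_tendsto₀ h hc
  rw [pow_zero, one_smul, dist_eq_norm, le_div_iff₀ (by positivity)] at this
  linarith

/-- If the segment from `x` to `y` avoids the origin, then a function with rapidly decreasing
differential has the same limit along the rays through `x` and `y`. -/
theorem tendsto_of_decay_of_segment {φ : SchwartzMap E (E →L[ℝ] ℝ)}
    (hs : ∀ x, HasFDerivAt s (φ x) x) {x y : E} (h0 : (0 : E) ∉ segment ℝ x y) {c : ℝ}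
    (hc : Tendsto (fun k : ℕ => s ((2 : ℝ) ^ k • x)) atTop (𝓝 c)) :
    Tendsto (fun k : ℕ => s ((2 : ℝ) ^ k • y)) atTop (𝓝 c) := by
  obtain ⟨C, hC0, hC⟩ := norm_sub_le_of_decay hs 2
  have hcomp : IsCompact (segment ℝ x y) := by
    rw [← convexHull_pair]
    exact (Set.toFinite {x, y}).isCompact_convexHull ℝ
  obtain ⟨w, hw, hw'⟩ := hcomp.exists_isMinOn ⟨x, left_mem_segment ℝ x y⟩ continuous_norm.continuousOn
  have hδ : 0 < ‖w‖ := norm_pos_iff.2 fun h => h0 (h ▸ hw)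
  have hlim : Tendsto (fun k : ℕ => C / ‖w‖ ^ 2 * ‖y - x‖ * (1 / 2 : ℝ) ^ k) atTop (𝓝 0) := by
    simpa using (tendsto_pow_atTop_nhds_zero_of_lt_one (by norm_num : (0 : ℝ) ≤ 1 / 2)
      (by norm_num)).const_mul (C / ‖w‖ ^ 2 * ‖y - x‖)
  have hd : Tendsto (fun k : ℕ => s ((2 : ℝ) ^ k • y) - s ((2 : ℝ) ^ k • x)) atTop (𝓝 0) := by
    refine squeeze_zero_norm (fun k => ?_) hlim
    refine (hC ((2 : ℝ) ^ k • x) ((2 : ℝ) ^ k • y) (2 ^ k * ‖w‖) (by positivity) ?_).trans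
      (le_of_eq ?_)
    · rintro z ⟨a, b, ha, hb, hab, rfl⟩
      rw [smul_comm a, smul_comm b, ← smul_add, norm_smul, norm_pow, Real.norm_ofNat]
      gcongr
      exact hw' ⟨a, b, ha, hb, hab, rfl⟩
    · rw [← smul_sub, norm_smul, norm_pow, Real.norm_ofNat, one_div, inv_pow]
      field_simp
  simpa using hd.add hc

/-- In dimension at least two the limits along all rays agree, as any two rays can be joined by at
most two segments that avoid the origin. -/
theorem tendsto_of_decay_of_one_lt_rank (hE : 1 < Module.rank ℝ E)
    {φ : SchwartzMap E (E →L[ℝ] ℝ)} (hs : ∀ x, HasFDerivAt s (φ x) x) {x y : E} (hx : x ≠ 0)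
    (hy : y ≠ 0) {c : ℝ} (hc : Tendsto (fun k : ℕ => s ((2 : ℝ) ^ k • x)) atTop (𝓝 c)) :
    Tendsto (fun k : ℕ => s ((2 : ℝ) ^ k • y)) atTop (𝓝 c) := by
  by_cases h0 : (0 : E) ∈ segment ℝ x y
  · obtain ⟨z, hz⟩ := exists_linearIndependent_pair_of_one_lt_rank hE hx
    rw [LinearIndependent.pair_iff] at hz
    obtain ⟨a, b, ha, hb, hab, h⟩ := h0
    have hb0 : b ≠ 0 := by
      rintro rfl
      rw [zero_smul, add_zero, smul_eq_zero] at h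
      rcases h with h | h
      · simp [h] at hab
      · exact hx h
    have hyx : y = (-(a / b)) • x := by
      have : b • y = b • ((-(a / b)) • x) := by
        rw [smul_smul, mul_neg, mul_div_cancel₀ _ hb0, neg_smul]
        exact eq_neg_of_add_eq_zero_right h
      exact smul_right_injective E hb0 this
    have hμ : -(a / b) ≠ 0 := by
      intro h'
      rw [h', zero_smul] at hyx
      exact hy hyx
    have h1 : (0 : E) ∉ segment ℝ x z := by
      rintro ⟨p, q, hp, hq, hpq, h⟩
      obtain ⟨rfl, rfl⟩ := hz p q h
      simp at hpq
    have h2 : (0 : E) ∉ segment ℝ z y := by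
      rintro ⟨p, q, hp, hq, hpq, h⟩
      rw [hyx, smul_smul, add_comm] at h
      obtain ⟨h3, rfl⟩ := hz _ p h
      rcases mul_eq_zero.1 h3 with rfl | h3
      · simp at hpq
      · exact hμ h3
    exact tendsto_of_decay_of_segment hs h2 (tendsto_of_decay_of_segment hs h1 hc)
  · exact tendsto_of_decay_of_segment hs h0 hc

/-- In dimension at least two, a function with Schwartz differential is a Schwartz function up to
an additive constant. (On the line, a primitive may have different limits at the two ends.) -/
theorem exists_schwartz_primitive (hE : 1 < Module.rank ℝ E) (φ : SchwartzMap E (E →L[ℝ] ℝ))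
    (hs : ∀ x, HasFDerivAt s (φ x) x) :
    ∃ ψ : SchwartzMap E ℝ, ∀ x, HasFDerivAt ψ (φ x) x := by
  obtain ⟨x0, hx0⟩ : ∃ x : E, x ≠ 0 := by
    by_contra! h
    have : Subsingleton E := ⟨fun a b => by rw [h a, h b]⟩
    rw [rank_subsingleton'] at hE
    exact absurd hE (by simp)
  obtain ⟨C, -, hC⟩ := norm_sub_limit_le_of_decay hs 0
  obtain ⟨c, hc⟩ := cauchySeq_tendsto_of_complete (hC x0 hx0).1
  have hfd : fderiv ℝ (fun x => s x - c) = φ := by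
    funext x
    exact ((hs x).sub_const c).fderiv
  have hdiff : Differentiable ℝ fun x => s x - c :=
    fun x => ((hs x).sub_const c).differentiableAt
  have hpos : ∀ N : ℕ, ∃ C : ℝ, 0 ≤ C ∧ ∀ x, ‖x‖ ^ (N + 1) * ‖s x - c‖ ≤ C := by
    intro N
    obtain ⟨C, hC0, hC⟩ := norm_sub_limit_le_of_decay hs N
    refine ⟨C, hC0, fun x => ?_⟩
    by_cases hx : x = 0
    · simpa [hx] using hC0
    · exact (hC x hx).2 c (tendsto_of_decay_of_one_lt_rank hE hs hx0 hx hc)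
  refine ⟨⟨fun x => s x - c, ?_, ?_⟩, fun x => (hs x).sub_const c⟩
  · rw [contDiff_infty_iff_fderiv, hfd]
    exact ⟨hdiff, φ.smooth ⊤⟩
  · intro k m
    rcases m with _ | m
    · simp only [norm_iteratedFDeriv_zero]
      rcases k with _ | k
      · obtain ⟨C, hC0, hC⟩ := hpos 0
        obtain ⟨K, hK0, hK⟩ := φ.decay 0 0
        simp only [pow_zero, one_mul, norm_iteratedFDeriv_zero, zero_add, pow_one] at hC hK ⊢
        refine ⟨C + (K + ‖s 0 - c‖), fun x => ?_⟩
        rcases le_total 1 ‖x‖ with hx | hx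
        · have h1 := hC x
          have h2 : ‖s x - c‖ ≤ ‖x‖ * ‖s x - c‖ := le_mul_of_one_le_left (norm_nonneg _) hx
          have h3 := hK0.le
          have h4 := norm_nonneg (s 0 - c)
          linarith
        · have h1 := convex_univ.norm_image_sub_le_of_norm_hasFDerivWithin_le
            (fun z _ => (hs z).hasFDerivWithinAt) (fun z _ => hK z) (Set.mem_univ (0 : E))
            (Set.mem_univ x)
          have h3 := hK0.le
          have h2 : K * ‖x - 0‖ ≤ K := by
            rw [sub_zero]
            exact mul_le_of_le_one_right h3 hx
          have h4 : ‖s x - c‖ ≤ ‖s x - s 0‖ + ‖s 0 - c‖ := norm_sub_le_norm_sub_add_norm_sub _ _ _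
          linarith
      · obtain ⟨C, -, hC⟩ := hpos k
        exact ⟨C, hC⟩
    · obtain ⟨C, -, hC⟩ := φ.decay k m
      refine ⟨C, fun x => ?_⟩
      rw [← norm_iteratedFDeriv_fderiv, hfd]
      exact hC x

end Decay

/-! ### Smooth and rapidly decreasing coefficients -/

section Smooth

variable {n : ℕ}

/-- The rapidly decreasing functions among the smooth functions. -/
def schwartzSub (n : ℕ) : AddSubgroup (smoothRing n).carrier where
  carrier := {f : smoothSubring n |
    ∃ φ : SchwartzMap (EuclideanSpace ℝ (Fin n)) ℝ, ∀ x, f.1 x = φ x}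
  zero_mem' := ⟨0, fun _ => rfl⟩
  add_mem' := by
    rintro f g ⟨φ, hφ⟩ ⟨ψ, hψ⟩
    exact ⟨φ + ψ, fun x => congrArg₂ (· + ·) (hφ x) (hψ x)⟩
  neg_mem' := by
    rintro f ⟨φ, hφ⟩
    exact ⟨-φ, fun x => congrArg Neg.neg (hφ x)⟩

theorem isDiffSubring_schwartzSub (n : ℕ) : (smoothRing n).IsDiffSubring (schwartzSub n) where
  mul_mem := by
    rintro f ⟨φ, hφ⟩ g ⟨ψ, hψ⟩
    exact ⟨SchwartzMap.pairing (ContinuousLinearMap.mul ℝ ℝ) φ ψ,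
      fun x => congrArg₂ (· * ·) (hφ x) (hψ x)⟩
  der_mem := by
    rintro i f ⟨φ, hφ⟩
    refine ⟨LineDeriv.lineDerivOp (EuclideanSpace.single i (1 : ℝ)) φ, fun x => ?_⟩
    have : Subtype.val (p := (· ∈ smoothSubring n)) f = φ := funext hφ
    rw [SchwartzMap.lineDerivOp_apply_eq_fderiv, ← this]
    rfl

theorem clm_apply_eq_sum {F : Type*} [NormedAddCommGroup F] [NormedSpace ℝ F]
    (T : EuclideanSpace ℝ (Fin n) →L[ℝ] F) (v : EuclideanSpace ℝ (Fin n)) :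
    T v = ∑ i, v i • T (EuclideanSpace.single i 1) := by
  have h := (EuclideanSpace.basisFun (Fin n) ℝ).sum_repr v
  simp only [EuclideanSpace.basisFun_repr, EuclideanSpace.basisFun_apply] at h
  conv_lhs => rw [← h]
  simp only [map_sum, map_smul]

theorem closedFormsExact_schwartzSub (hn : 2 ≤ n) :
    (smoothRing n).ClosedFormsExact (schwartzSub n) := by
  intro F hF hc
  choose φ hφ using hF
  let p : Fin n → (EuclideanSpace ℝ (Fin n) →L[ℝ] ℝ) := fun i => EuclideanSpace.proj i
  let θ : SchwartzMap (EuclideanSpace ℝ (Fin n)) (EuclideanSpace ℝ (Fin n) →L[ℝ] ℝ) :=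
    ∑ i, SchwartzMap.postcompCLM (𝕜 := ℝ)
      (ContinuousLinearMap.toSpanSingleton ℝ (p i)) (φ i)
  have hθ : ∀ x, θ x = ∑ i, φ i x • (p i) := by
    intro x
    simp [θ]
  have hdθ : ∀ a v w, fderiv ℝ θ a v w = ∑ i, ∑ l, (v l * w i) *
      fderiv ℝ (φ i) a (EuclideanSpace.single l 1) := by
    intro a v w
    have h1 : HasFDerivAt θ (∑ i, (fderiv ℝ (φ i) a).smulRight (p i)) a := by
      have h2 : (θ : EuclideanSpace ℝ (Fin n) → _) =
          fun x => ∑ i, φ i x • (p i) := funext hθ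
      rw [h2]
      exact HasFDerivAt.fun_sum fun i _ => 
        HasFDerivAt.smul_const (F := EuclideanSpace ℝ (Fin n) →L[ℝ] ℝ) ((φ i).hasFDerivAt a) (p i)
    rw [h1.fderiv]
    simp only [sum_apply, ContinuousLinearMap.smulRight_apply]
    refine Finset.sum_congr rfl fun i _ => ?_
    change fderiv ℝ (φ i) a v * w i = _
    rw [clm_apply_eq_sum (fderiv ℝ (φ i) a) v, Finset.sum_mul]
    exact Finset.sum_congr rfl fun l _ => mul_right_comm (v l) _ (w i)
  have hval : ∀ i, Subtype.val (p := (· ∈ smoothSubring n)) (F i) = φ i := fun i => funext (hφ i)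
  have hsymm : ∀ i l a, fderiv ℝ (φ i) a (EuclideanSpace.single l 1) =
      fderiv ℝ (φ l) a (EuclideanSpace.single i 1) := by
    intro i l a
    have := congrFun (congrArg (Subtype.val (p := (· ∈ smoothSubring n))) (hc l i)) a
    rw [← hval i, ← hval l]
    exact this
  obtain ⟨s, hs⟩ := convex_univ.exists_forall_hasFDerivAt_of_fderiv_symmetric isOpen_univ
    (fun x _ => (θ.hasFDerivAt x).differentiableAt.differentiableWithinAt) (fun a _ v w => by
      rw [hdθ, hdθ, Finset.sum_comm]
      exact Finset.sum_congr rfl fun i _ => Finset.sum_congr rfl fun l _ => by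
        rw [hsymm, mul_comm (v i)])
  have hrank : 1 < Module.rank ℝ (EuclideanSpace ℝ (Fin n)) := by
    rw [← Module.finrank_eq_rank, finrank_euclideanSpace_fin]
    exact_mod_cast hn
  obtain ⟨ψ, hψ⟩ := exists_schwartz_primitive hrank θ (fun x => hs x (Set.mem_univ x))
  refine ⟨(⟨ψ, ψ.smooth ⊤⟩ : smoothSubring n), ⟨ψ, fun _ => rfl⟩, fun i => ?_⟩
  refine Subtype.ext (p := (· ∈ smoothSubring n)) (funext fun x => ?_)
  change fderiv ℝ ψ x (EuclideanSpace.single i 1) = _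
  rw [(hψ x).fderiv, hθ, hφ]
  simp [p, PiLp.single_apply]

theorem mem_constants_smoothRing_iff (f : smoothSubring n) :
    f ∈ (smoothRing n).constants ↔ ∃ c : ℝ, ∀ x, f.1 x = c := by
  constructor
  · intro h
    refine ⟨f.1 0, fun x => is_const_of_fderiv_eq_zero (𝕜 := ℝ) (smooth_differentiable f)
      (fun x => ?_) x 0⟩
    ext v
    rw [clm_apply_eq_sum]
    refine Finset.sum_eq_zero fun i _ => ?_
    have := congrFun (congrArg (Subtype.val (p := (· ∈ smoothSubring n))) (h i)) x
    rw [show fderiv ℝ f.1 x (EuclideanSpace.single i 1) = 0 from this, smul_zero]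
  · rintro ⟨c, hc⟩ i
    have : f.1 = fun _ => c := funext hc
    refine Subtype.ext (p := (· ∈ smoothSubring n)) (funext fun x => ?_)
    change fderiv ℝ f.1 x (EuclideanSpace.single i 1) = 0
    simp [this]

end Smooth

/-! ### Formal power series -/

section PowerSeries

variable {n : ℕ} {k : Type u} [Field k]

open Finsupp in
/-- The formal Poincaré lemma for one-forms. The coefficient of the primitive at `x ^ d` is read
off from any `F i` with `d i ≠ 0`; closedness says that the choice of `i` does not matter. -/
theorem exists_pderiv_eq [CharZero k] (F : Fin n → MvPowerSeries (Fin n) k)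
    (hc : ∀ i j, MvPowerSeries.pderiv k i (F j) = MvPowerSeries.pderiv k j (F i)) :
    ∃ s : MvPowerSeries (Fin n) k, ∀ i, MvPowerSeries.pderiv k i s = F i := by
  classical
  have key : ∀ d : Fin n →₀ ℕ, ∃ a : k, ∀ i, ∀ d', d = d' + single i 1 →
      a * (d' i + 1) = MvPowerSeries.coeff d' (F i) := by
    intro d
    by_cases h : ∃ i, d i ≠ 0
    · obtain ⟨j, hj⟩ := h
      obtain ⟨e, rfl⟩ : ∃ e, d = e + single j 1 :=
        ⟨d - single j 1, (tsub_add_cancel_of_le (single_le_iff.2 (Nat.one_le_iff_ne_zero.2 hj))).symm⟩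
      have hej : (e j + 1 : k) ≠ 0 := Nat.cast_add_one_ne_zero _
      refine ⟨MvPowerSeries.coeff e (F j) / (e j + 1), fun i d' hd => ?_⟩
      by_cases hij : i = j
      · subst hij
        obtain rfl := add_right_cancel hd
        rw [div_mul_cancel₀ _ hej]
      · -- Both `e` and `d'` are obtained by adding a unit vector to the same exponent `f`.
        obtain ⟨f, rfl⟩ : ∃ f, e = f + single i 1 := by
          refine ⟨e - single i 1, (tsub_add_cancel_of_le (single_le_iff.2 ?_)).symm⟩
          have := DFunLike.congr_fun hd i
          simp only [Finsupp.add_apply, single_eq_same, single_eq_of_ne hij] at this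
          omega
        obtain rfl : f + single j 1 = d' := by
          rw [add_right_comm] at hd
          exact add_right_cancel hd
        have h1 := congrArg (MvPowerSeries.coeff f) (hc i j)
        rw [MvPowerSeries.coeff_pderiv, MvPowerSeries.coeff_pderiv] at h1
        have e1 : (f + single j 1 : Fin n →₀ ℕ) i = f i := by simp [single_eq_of_ne hij]
        have e2 : (f + single i 1 : Fin n →₀ ℕ) j = f j := by
          simp [single_eq_of_ne (Ne.symm hij)]
        rw [e2] at hej ⊢
        rw [e1, div_mul_eq_mul_div, h1, mul_div_cancel_right₀ _ hej]
    · push Not at h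
      refine ⟨0, fun i d' hd => ?_⟩
      have := h i
      simp [hd] at this
  choose s hs using key
  exact ⟨s, fun i => MvPowerSeries.ext fun d =>
    (MvPowerSeries.coeff_pderiv _ d).trans (hs _ i d rfl)⟩

theorem isDiffSubring_top {ι : Type} (A : DiffRing.{u} ι) : A.IsDiffSubring ⊤ where
  mul_mem _ _ _ _ := trivial
  der_mem _ _ _ := trivial

theorem closedFormsExact_powerSeriesRing (n : ℕ) (k : Type u) [Field k] [CharZero k] :
    (powerSeriesRing n k).ClosedFormsExact ⊤ := by
  intro F _ hc
  obtain ⟨s, hs⟩ := exists_pderiv_eq F hc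
  exact ⟨s, trivial, hs⟩

theorem mem_constants_powerSeriesRing_iff [CharZero k] (f : MvPowerSeries (Fin n) k) :
    f ∈ (powerSeriesRing n k).constants ↔ f ∈ Set.range (MvPowerSeries.C (σ := Fin n) (R := k)) := by
  classical
  constructor
  · intro h
    refine ⟨MvPowerSeries.coeff 0 f, MvPowerSeries.ext fun d => ?_⟩
    rw [MvPowerSeries.coeff_C]
    split_ifs with hd
    · rw [hd]
    · obtain ⟨i, hi⟩ := Finsupp.ne_iff.1 hd
      obtain ⟨e, rfl⟩ : ∃ e, d = e + Finsupp.single i 1 := ⟨d - Finsupp.single i 1,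
        (tsub_add_cancel_of_le (Finsupp.single_le_iff.2 (Nat.one_le_iff_ne_zero.2 hi))).symm⟩
      have h1 : MvPowerSeries.pderiv k i f = 0 := h i
      have h2 := congrArg (MvPowerSeries.coeff e) h1
      rw [MvPowerSeries.coeff_pderiv, map_zero] at h2
      exact ((mul_eq_zero.1 h2).resolve_right (Nat.cast_add_one_ne_zero _)).symm
  · rintro ⟨c, rfl⟩ i
    exact MvPowerSeries.pderiv_C

end PowerSeries

/-! ### Translation to the sets of operators in question -/

section Sets

theorem negWith_top {n : ℕ} (A : DiffRing.{u} (Fin n)) : A.negWith ⊤ = A.neg := by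
  have h : ∀ (m : ℕ) (h : m ≤ n) (L : (A.tower m h).carrier), L ∈ A.coeffsSub ⊤ m h := by
    intro m
    induction m with
    | zero => exact fun _ _ => trivial
    | succ m ih => exact fun _ _ _ => ih _ _
  exact Set.inter_eq_right.2 fun L _ => h n le_rfl L

theorem mem_coeffsSub_constants_iff_EConst {n : ℕ} {k : Type u} [Field k] [CharZero k]
    (L : E n k) :
    L ∈ (powerSeriesRing n k).coeffsSub (powerSeriesRing n k).constants n le_rfl ↔
      L ∈ EConst n k :=
  DiffRing.mem_coeffsSub_iff mem_constants_powerSeriesRing_iff n le_rfl L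

theorem mem_coeffsSub_constants_iff_SmoothConst {n : ℕ} (L : SmoothOp n) :
    L ∈ (smoothRing n).coeffsSub (smoothRing n).constants n le_rfl ↔ L ∈ SmoothConst n :=
  DiffRing.mem_coeffsSub_iff mem_constants_smoothRing_iff n le_rfl L

theorem negWith_schwartzSub (n : ℕ) : (smoothRing n).negWith (schwartzSub n) = RapidMinus n :=
  congrArg (· ∩ (smoothRing n).neg) (Set.ext fun L =>
    DiffRing.mem_coeffsSub_iff (fun _ => Iff.rfl) n le_rfl L)

end Sets

end FormalPDO

theorem theorem1 (n : ℕ) (hn : 1 ≤ n) :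
    (∀ (k : Type u) [Field k] [CharZero k] (L : Fin n → FormalPDO.E n k),
      (∀ i, L i - (FormalPDO.powerSeriesRing n k).partialOp i ∈ FormalPDO.EMinus n k) →
      ((∀ i j, L i * L j - L j * L i = 0) ↔
        ∃ S : (FormalPDO.E n k)ˣ, (S : FormalPDO.E n k) - 1 ∈ FormalPDO.EMinus n k ∧
          ∀ i, L i = ↑S⁻¹ * (FormalPDO.powerSeriesRing n k).partialOp i * ↑S) ∧
      (∀ S S' : (FormalPDO.E n k)ˣ,
        (S : FormalPDO.E n k) - 1 ∈ FormalPDO.EMinus n k →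
        (∀ i, L i = ↑S⁻¹ * (FormalPDO.powerSeriesRing n k).partialOp i * ↑S) →
        (((S' : FormalPDO.E n k) - 1 ∈ FormalPDO.EMinus n k ∧
            ∀ i, L i = ↑S'⁻¹ * (FormalPDO.powerSeriesRing n k).partialOp i * ↑S') ↔
          (↑S' * ↑S⁻¹ : FormalPDO.E n k) - 1 ∈ FormalPDO.EConst n k ∩ FormalPDO.EMinus n k))) ∧
    (∀ L : Fin n → FormalPDO.SmoothOp n,
      (∀ i, L i - (FormalPDO.smoothRing n).partialOp i ∈ FormalPDO.RapidMinus n) →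
      (2 ≤ n → (∀ i j, L i * L j - L j * L i = 0) →
        ∃ S : (FormalPDO.SmoothOp n)ˣ, (S : FormalPDO.SmoothOp n) - 1 ∈ FormalPDO.RapidMinus n ∧
          ∀ i, L i = ↑S⁻¹ * (FormalPDO.smoothRing n).partialOp i * ↑S) ∧
      ((∃ S : (FormalPDO.SmoothOp n)ˣ, (S : FormalPDO.SmoothOp n) - 1 ∈ FormalPDO.RapidMinus n ∧
          ∀ i, L i = ↑S⁻¹ * (FormalPDO.smoothRing n).partialOp i * ↑S) →
        ∀ i j, L i * L j - L j * L i = 0) ∧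
      (∀ S S' : (FormalPDO.SmoothOp n)ˣ,
        (S : FormalPDO.SmoothOp n) - 1 ∈ FormalPDO.RapidMinus n →
        (∀ i, L i = ↑S⁻¹ * (FormalPDO.smoothRing n).partialOp i * ↑S) →
        (((S' : FormalPDO.SmoothOp n) - 1 ∈ FormalPDO.RapidMinus n ∧
            ∀ i, L i = ↑S'⁻¹ * (FormalPDO.smoothRing n).partialOp i * ↑S') ↔
          (↑S' * ↑S⁻¹ : FormalPDO.SmoothOp n) - 1 ∈
            FormalPDO.SmoothConst n ∩ FormalPDO.RapidMinus n))) := by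

  refine ⟨fun k _ _ L hL => ⟨⟨fun hc => ?_, ?_⟩, fun S S' hS1 hS => ?_⟩,
    fun L hL => ⟨fun h2 hc => ?_, ?_, fun S S' hS1 hS => ?_⟩⟩
  · rw [FormalPDO.EMinus, ← FormalPDO.negWith_top] at hL ⊢
    exact FormalPDO.DiffRing.exists_dressing hn (FormalPDO.isDiffSubring_top _)
      (FormalPDO.closedFormsExact_powerSeriesRing n k) hL hc
  · rintro ⟨S, -, hS⟩
    exact FormalPDO.DiffRing.comm_of_dressing hS
  · rw [FormalPDO.EMinus, ← FormalPDO.negWith_top] at hS1 ⊢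
    rw [Set.mem_inter_iff, ← FormalPDO.mem_coeffsSub_constants_iff_EConst]
    exact FormalPDO.DiffRing.dressing_unique hn (FormalPDO.isDiffSubring_top _) hS1 hS
  · rw [← FormalPDO.negWith_schwartzSub] at hL ⊢
    exact FormalPDO.DiffRing.exists_dressing hn (FormalPDO.isDiffSubring_schwartzSub n)
      (FormalPDO.closedFormsExact_schwartzSub h2) hL hc
  · rintro ⟨S, -, hS⟩
    exact FormalPDO.DiffRing.comm_of_dressing hS
  · rw [← FormalPDO.negWith_schwartzSub] at hS1 ⊢
    rw [Set.mem_inter_iff, ← FormalPDO.mem_coeffsSub_constants_iff_SmoothConst]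
    exact FormalPDO.DiffRing.dressing_unique hn (FormalPDO.isDiffSubring_schwartzSub n) hS1 hS
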